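/- Let $V$ be a finite set with $n=|V|$, let $E$ be a finite set of hyperedges $e\subseteq V$, and let each $e\in E$ ring independently at rate $r_e>0$. When $e$ rings, the particles occupying $e$ are permuted by a uniformly random permutation of the vertices of $e$. This is the uniform interchange process. $\mathrm{IP}(k)$ is the continuous-time Markov chain on $k$-tuples of distinct vertices that describes the positions of $k$ labelled particles ($1\le k\le n$), and $\mathrm{RW}(1)=\mathrm{IP}(1)$ is the motion of a single particle. These chains are reversible with respect to the uniform distribution. Let $t_{\mathrm{rel}}$ be the inverse of the spectral gap (the second smallest eigenvalue, with multiplicity, of minus the generator), with $t_{\mathrm{rel}}=\infty$ if the chain is reducible. Let $t_{\mathrm{mix}}(\varepsilon)=\inf\{t\ge 0:\max_x\|\mathcal L[X_t^x]-\pi\|_{\mathrm{TV}}\le\varepsilon\}$, where $X^x$ is the chain started at $x$ and $\pi$ is the uniform distribution, with $\inf\emptyset=\infty$ (and $0\cdot\infty=0$). Put $R=\sum_{e\in E} r_e|e|(|e|-1)$. There is an absolute constant $C>0$ such that the following two statements hold. (i) For every $b\in(0,1]$ there is $n_0(b)$ such that, for every uniform interchange process on a hypergraph with $n\ge n_0(b)$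 vertices and every $1\le k\le n$, if $Rkn^{-2}\,t_{\mathrm{mix}}^{\mathrm{RW}(1)}(n^{-b})\le n^{-b}$, then $$t_{\mathrm{rel}}^{\mathrm{IP}(k)}\le C\,b^{-1}\,t_{\mathrm{rel}}^{\mathrm{RW}(1)}.$$ (ii) For every uniform interchange process on a finite hypergraph with $n\ge 2$ vertices, regardless of the value of $R$, $$t_{\mathrm{rel}}^{\mathrm{IP}(2)}\le C\,t_{\mathrm{rel}}^{\mathrm{RW}(1)}.$$ -/

import Mathlib

open Equiv

universe u

noncomputable section

/-- A finite hypergraph on the vertex set `V`: a finite set of hyperedges (subsets of `V`), the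
hyperedge `e` ringing at rate `rate e > 0`. (Hyperedges with at most one vertex are permitted;
their rings have no effect on the dynamics.) -/
structure RatedHypergraph (V : Type u) where
  edges : Finset (Finset V)
  rate : Finset V → ℝ
  rate_pos : ∀ e ∈ edges, 0 < rate e

namespace RatedHypergraph

variable {V : Type u}

/-- `R = ∑ₑ rₑ |e| (|e| - 1)`. -/
def R (H : RatedHypergraph V) : ℝ :=
  ∑ e ∈ H.edges, H.rate e * (e.card : ℝ) * ((e.card : ℝ) - 1)

variable [DecidableEq V]

/-- The Q-matrix (generator) of the uniform interchange dynamics of `H`, on any finite set `S` of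
configurations on which the permutations of `V` act. At rate `rate e` the hyperedge `e` rings, and
then a uniformly random permutation `σ` of `e` (one of `|e|!`, extended by the identity off `e`) is
applied to the current configuration `x`, which becomes `σ • x`. -/
def generator (H : RatedHypergraph V) (S : Type u) [DecidableEq S] [MulAction (Perm V) S] :
    Matrix S S ℝ := Matrix.of fun x y =>
  ∑ e ∈ H.edges, H.rate e *
    ((∑ σ : Perm {v // v ∈ e}, if Perm.ofSubtype σ • x = y then (1 : ℝ) else 0)
        / (e.card.factorial : ℝ)
      - if x = y then 1 else 0)

/-- The Q-matrix of the random walk `RW(1)`: one particle moving on `V`. -/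
def rw1 (H : RatedHypergraph V) : Matrix V V ℝ := H.generator V

open Classical in
/-- The Q-matrix of the uniform interchange process `IP(k)` with `k` labelled particles: its states
are the `k`-tuples of distinct vertices, and `σ • (x₁, …, x_k) = (σ x₁, …, σ x_k)`. -/
def ip (H : RatedHypergraph V) (k : ℕ) : Matrix (Fin k ↪ V) (Fin k ↪ V) ℝ :=
  H.generator (Fin k ↪ V)

end RatedHypergraph

namespace MarkovChain

open scoped ENNReal NNReal

variable {S : Type u} [Fintype S]

/-- The uniform distribution on a finite set `S`. -/
def uniform (S : Type u) [Fintype S] : S → ℝ := fun _ => 1 / (Fintype.card S : ℝ)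

/-- Total-variation distance of two distributions on a finite set. -/
def tvDist (μ ν : S → ℝ) : ℝ := (1 / 2) * ∑ a, |μ a - ν a|

/-- The law at time `t` of the continuous-time Markov chain with Q-matrix `Q` started from `x`: the
row of `exp (t Q)` indexed by `x`. -/
def law [DecidableEq S] (Q : Matrix S S ℝ) (t : ℝ) (x : S) : S → ℝ :=
  fun y => NormedSpace.exp (t • Q) x y

open Classical in
/-- The `ε` total-variation mixing time of the chain with Q-matrix `Q` and stationary distribution
`π`: the infimum of all `t ≥ 0` at which the law of the chain is within `ε` of `π` for every
starting point. It is `∞` if there is no such `t`. -/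
def mixingTime (Q : Matrix S S ℝ) (π : S → ℝ) (ε : ℝ) : ℝ≥0∞ :=
  ⨅ (t : ℝ≥0) (_ : ∀ x, tvDist (law Q t x) π ≤ ε), (t : ℝ≥0∞)

/-- The spectral gap of the chain with Q-matrix `Q`, reversible with respect to `π`: the least
eigenvalue of `-Q` on the functions orthogonal to the constants in `ℓ²(π)`, that is, the second
smallest eigenvalue of `-Q` counted with multiplicity. It is `0` for a reducible chain,
and `∞` for a chain with one state. -/
def spectralGap (Q : Matrix S S ℝ) (π : S → ℝ) : ℝ≥0∞ :=
  ⨅ (l : ℝ) (_ : ∃ f : S → ℝ, f ≠ 0 ∧ ∑ x, π x * f x = 0 ∧ (-Q).mulVec f = l • f),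
    ENNReal.ofReal l

/-- The relaxation time: the inverse of the spectral gap (with `1 / 0 = ∞`). -/
def relaxationTime (Q : Matrix S S ℝ) (π : S → ℝ) : ℝ≥0∞ := (spectralGap Q π)⁻¹

end MarkovChain

/-- The dynamics is reversible with respect to the uniform distribution. -/
theorem RatedHypergraph.generator_isSymm {V : Type u} [DecidableEq V] (H : RatedHypergraph V)
    (S : Type u) [DecidableEq S] [MulAction (Perm V) S] : (H.generator S).IsSymm := by
  ext x y
  simp only [RatedHypergraph.generator, Matrix.transpose_apply, Matrix.of_apply]
  refine Finset.sum_congr rfl fun e _ => ?_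
  have h : (∑ σ : Perm {v // v ∈ e}, if Perm.ofSubtype σ • y = x then (1 : ℝ) else 0)
      = ∑ σ : Perm {v // v ∈ e}, if Perm.ofSubtype σ • x = y then (1 : ℝ) else 0 := by
    refine Fintype.sum_equiv (Equiv.inv _) _ _ fun σ => ?_
    simp only [Equiv.inv_apply, map_inv, inv_smul_eq_iff]
    exact if_congr eq_comm rfl rfl
  rw [h]
  simp only [eq_comm]

/-- The rows of the Q-matrix sum to zero. -/
theorem RatedHypergraph.generator_row_sum {V : Type u} [DecidableEq V] (H : RatedHypergraph V)
    (S : Type u) [Fintype S] [DecidableEq S] [MulAction (Perm V) S] (x : S) :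
    ∑ y, H.generator S x y = 0 := by
  simp only [RatedHypergraph.generator, Matrix.of_apply]
  rw [Finset.sum_comm]
  refine Finset.sum_eq_zero fun e _ => ?_
  rw [← Finset.mul_sum, Finset.sum_sub_distrib, ← Finset.sum_div, Finset.sum_comm]
  have : (e.card.factorial : ℝ) ≠ 0 := by positivity
  simp [Fintype.card_perm, this]

end

/-! Both statements are lower bounds on an eigenvalue `l` of the many-particle chain in terms of a
lower bound `γ` for the gap of a single particle.

Two particles. Extend an eigenfunction by zero to the diagonal of `V × V`, giving `F`. If the
marginal `y ↦ ∑ x, F (x, y)` is nonzero, it is an eigenfunction of the single particle and `l ≥ γ`.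
Otherwise every section `F (·, y)` has mean zero, and the single-particle Poincaré inequality can be
applied to it, with its value at `x = y` replaced by a free number `d y`. An edge avoiding `y` costs
only the deviations of `F` from its average over that edge. An edge `e` through `y` costs in
addition `(d y - m e) ^ 2`, where `m e` is the average of `F` over ordered pairs of distinct
vertices of `e`. For two edges through `y` the numbers `m e` differ by at most a sum of six
deviations, so some `d y` is near all of them on average. Summing over `y` gives `pair_poincare`,
with constant 73 and no reference to `R`.

Many particles. Among pairs of configurations that differ in the position of one particle only,
choose one at which an eigenfunction `f` varies most, by `M > 0`. Run both for time `s + T` under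
the same permutations. Once `s` is of order `log n / γ`, the two-particle result makes the law of
every pair of particles comparable to uniform, so from then on the chosen particle meets the others
at expected rate `O(R k / n ^ 2)`. During the remaining time `T` it may thus be replaced by an
independent walker, at a relative cost `O(R k T / n ^ 2)`; if `T` is a mixing time, the walker
forgets its start. Hence `exp (-l (s + T)) M` is at most `O(n ^ (-b)) M` (`exp_eigenvalue_le`). As
`s + T` is `O(log n / γ)`, this forces `l` to be at least a constant times `b γ`. -/

noncomputable section

open scoped Matrix Matrix.Norms.Operator

/-! ### Semigroups of finite Q-matrices. -/

namespace MarkovChain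

variable {S S' : Type*} [Fintype S] [DecidableEq S] [Fintype S'] [DecidableEq S']

/-- The semigroup `exp (t Q)` acting on functions. -/
def semigroup (Q : Matrix S S ℝ) (t : ℝ) (f : S → ℝ) : S → ℝ :=
  NormedSpace.exp (t • Q) *ᵥ f

theorem hasDerivAt_exp_apply (Q : Matrix S S ℝ) (t : ℝ) (x y : S) :
    HasDerivAt (fun u : ℝ => NormedSpace.exp (u • Q) x y)
      ((NormedSpace.exp (t • Q) * Q) x y) t :=
  ((LinearMap.toContinuousLinearMap (Matrix.entryLinearMap ℝ ℝ x y)).hasFDerivAt).comp_hasDerivAt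
    t (hasDerivAt_exp_smul_const (𝕂 := ℝ) Q t)

theorem exp_mul_comm (Q : Matrix S S ℝ) (t : ℝ) :
    NormedSpace.exp (t • Q) * Q = Q * NormedSpace.exp (t • Q) :=
  (hasDerivAt_exp_smul_const (𝕂 := ℝ) Q t).unique (hasDerivAt_exp_smul_const' (𝕂 := ℝ) Q t)

theorem hasDerivAt_semigroup_apply (Q : Matrix S S ℝ) (f : S → ℝ) (t : ℝ) (x : S) :
    HasDerivAt (fun u => semigroup Q u f x) (semigroup Q t (Q *ᵥ f) x) t := by
  have h := HasDerivAt.fun_sum (u := Finset.univ)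
    fun y _ => (hasDerivAt_exp_apply Q t x y).mul_const (f y)
  have e : semigroup Q t (Q *ᵥ f) = (NormedSpace.exp (t • Q) * Q) *ᵥ f := by
    rw [semigroup, Matrix.mulVec_mulVec]
  rw [e]
  exact h

theorem semigroup_mulVec_comm (Q : Matrix S S ℝ) (f : S → ℝ) (t : ℝ) :
    semigroup Q t (Q *ᵥ f) = Q *ᵥ semigroup Q t f := by
  simp only [semigroup, Matrix.mulVec_mulVec, exp_mul_comm]

@[simp] theorem semigroup_zero (Q : Matrix S S ℝ) (f : S → ℝ) : semigroup Q 0 f = f := by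
  simp [semigroup]

theorem semigroup_add_fun (Q : Matrix S S ℝ) (t : ℝ) (f g : S → ℝ) :
    semigroup Q t (f + g) = semigroup Q t f + semigroup Q t g := Matrix.mulVec_add _ _ _

theorem semigroup_sub_fun (Q : Matrix S S ℝ) (t : ℝ) (f g : S → ℝ) :
    semigroup Q t (f - g) = semigroup Q t f - semigroup Q t g := Matrix.mulVec_sub _ _ _

theorem semigroup_smul_fun (Q : Matrix S S ℝ) (t c : ℝ) (f : S → ℝ) :
    semigroup Q t (c • f) = c • semigroup Q t f := Matrix.mulVec_smul _ _ _

theorem semigroup_sum_fun {ι : Type*} (s : Finset ι) (Q : Matrix S S ℝ) (t : ℝ)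
    (f : ι → S → ℝ) : semigroup Q t (∑ i ∈ s, f i) = ∑ i ∈ s, semigroup Q t (f i) :=
  map_sum (NormedSpace.exp (t • Q)).mulVecLin f s

/-- Differentiation of `u ↦ exp (u Q) g(u)`. -/
theorem hasDerivAt_semigroup_apply_of_hasDerivAt (Q : Matrix S S ℝ) (g : ℝ → S → ℝ)
    (g' : S → ℝ) (a c t : ℝ) (x : S)
    (hg : ∀ y, HasDerivAt (fun u => g u y) (g' y) t) :
    HasDerivAt (fun u => semigroup Q (c + a * u) (g u) x)
      (semigroup Q (c + a * t) (a • Q *ᵥ g t + g') x) t := by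
  have h0 : HasDerivAt (fun u : ℝ => c + a * u) a t := by
    simpa using ((hasDerivAt_id t).const_mul a).const_add c
  have h := HasDerivAt.fun_sum (u := Finset.univ)
    fun y _ => ((hasDerivAt_exp_apply Q (c + a * t) x y).comp t h0).mul (hg y)
  have e : (∑ y, ((NormedSpace.exp ((c + a * t) • Q) * Q) x y * a * g t y
      + NormedSpace.exp ((c + a * t) • Q) x y * g' y))
      = semigroup Q (c + a * t) (a • Q *ᵥ g t + g') x := by
    rw [semigroup_add_fun, semigroup_smul_fun, Finset.sum_add_distrib]
    simp only [semigroup, Matrix.mulVec_mulVec, Pi.add_apply, Pi.smul_apply, smul_eq_mul]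
    simp only [Matrix.mulVec, dotProduct, Finset.mul_sum]
    congr 1
    exact Finset.sum_congr rfl fun y _ => by ring
  rw [← e]
  exact h

theorem semigroup_neg_semigroup (Q : Matrix S S ℝ) (t : ℝ) (f : S → ℝ) :
    semigroup Q t (semigroup Q (-t) f) = f := by
  have h : NormedSpace.exp (t • Q) * NormedSpace.exp ((-t) • Q) = 1 := by
    rw [← Matrix.exp_add_of_commute _ _ ((Commute.refl Q).smul_left _ |>.smul_right _), ← add_smul]
    simp
  simp only [semigroup, Matrix.mulVec_mulVec, h, Matrix.one_mulVec]

/-- Uniqueness of the solution of `u' = Q u`. -/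
theorem eq_semigroup_of_hasDerivAt (Q : Matrix S S ℝ) (g : ℝ → S → ℝ)
    (hg : ∀ t y, HasDerivAt (fun u => g u y) ((Q *ᵥ g t) y) t) (t : ℝ) :
    g t = semigroup Q t (g 0) := by
  have key : semigroup Q (-t) (g t) = g 0 := by
    ext x
    have hd : ∀ s, HasDerivAt (fun u => semigroup Q (0 + (-1) * u) (g u) x) 0 s := fun s => by
      have h := hasDerivAt_semigroup_apply_of_hasDerivAt Q g (Q *ᵥ g s) (-1) 0 s x (hg s)
      have hz : ((-1 : ℝ) • Q *ᵥ g s + Q *ᵥ g s) = 0 := by simp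
      rw [hz] at h
      simpa [semigroup] using h
    have := is_const_of_deriv_eq_zero (fun s => (hd s).differentiableAt) (fun s => (hd s).deriv) t 0
    simpa using this
  rw [← key, semigroup_neg_semigroup]

/-- Both sides solve `u' = Q u` with the same initial value. Applied to equivariant maps, this
allows particles to be forgotten or added. -/
theorem semigroup_intertwine (Q : Matrix S S ℝ) (Q' : Matrix S' S' ℝ) (π : S → S')
    (h : ∀ g : S' → ℝ, Q *ᵥ (g ∘ π) = (Q' *ᵥ g) ∘ π) (t : ℝ) (g : S' → ℝ) :
    semigroup Q t (g ∘ π) = semigroup Q' t g ∘ π := by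
  have := eq_semigroup_of_hasDerivAt Q (fun t => semigroup Q' t g ∘ π) (fun t y => by
    rw [h, ← semigroup_mulVec_comm]
    exact hasDerivAt_semigroup_apply Q' g t (π y)) t
  simpa using this.symm

theorem semigroup_of_mulVec_eq_smul (Q : Matrix S S ℝ) (f : S → ℝ) (l : ℝ)
    (h : Q *ᵥ f = l • f) (t : ℝ) : semigroup Q t f = Real.exp (l * t) • f := by
  have := eq_semigroup_of_hasDerivAt Q (fun t => Real.exp (l * t) • f) (fun t y => by
    rw [Matrix.mulVec_smul, h]
    have h1 : HasDerivAt (fun t => Real.exp (l * t)) (Real.exp (l * t) * l) t := by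
      simpa using ((hasDerivAt_id t).const_mul l).exp
    simpa [mul_assoc] using h1.mul_const (f y)) t
  simpa using this.symm

theorem semigroup_const (Q : Matrix S S ℝ) (h : ∀ x, ∑ y, Q x y = 0) (t c : ℝ) :
    semigroup Q t (fun _ => c) = fun _ => c := by
  have := semigroup_of_mulVec_eq_smul Q (fun _ => c) 0 (by
    ext x
    simp [Matrix.mulVec, dotProduct, ← Finset.sum_mul, h]) t
  simpa using this

theorem exp_apply_nonneg_of_nonneg (M : Matrix S S ℝ) (h : ∀ x y, 0 ≤ M x y) (x y : S) :
    0 ≤ NormedSpace.exp M x y := by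
  have hs := (NormedSpace.exp_series_hasSum_exp' (𝕂 := ℝ) M).map (Matrix.entryAddHom ℝ x y)
    (LinearMap.toContinuousLinearMap (Matrix.entryLinearMap ℝ ℝ x y)).continuous
  refine hs.nonneg fun n => ?_
  have hp : ∀ (n : ℕ) (x y : S), 0 ≤ (M ^ n) x y := by
    intro n
    induction n with
    | zero => intro x y; simp only [pow_zero, Matrix.one_apply]; split_ifs <;> norm_num
    | succ n ih =>
      intro x y
      rw [pow_succ, Matrix.mul_apply]
      exact Finset.sum_nonneg fun z _ => mul_nonneg (ih x z) (h z y)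
  have := hp n x y
  simp only [Function.comp_apply, Matrix.entryAddHom_apply, Matrix.smul_apply, smul_eq_mul]
  positivity

theorem exp_apply_nonneg (Q : Matrix S S ℝ) (h : ∀ x y, x ≠ y → 0 ≤ Q x y) {t : ℝ} (ht : 0 ≤ t)
    (x y : S) : 0 ≤ NormedSpace.exp (t • Q) x y := by
  set c : ℝ := ∑ z, |Q z z| with hc
  have hcz : ∀ z, 0 ≤ Q z z + c := fun z => by
    have := Finset.single_le_sum (f := fun z => |Q z z|) (fun z _ => abs_nonneg _)
      (Finset.mem_univ z)
    change |Q z z| ≤ c at this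
    linarith [neg_abs_le (Q z z)]
  have e : t • Q = t • (Q + c • (1 : Matrix S S ℝ)) + (-(t * c)) • (1 : Matrix S S ℝ) := by
    rw [smul_add, smul_smul, add_assoc, ← add_smul]; simp
  have e2 : NormedSpace.exp ((-(t * c)) • (1 : Matrix S S ℝ))
      = Real.exp (-(t * c)) • (1 : Matrix S S ℝ) := by
    have := Matrix.exp_diagonal (fun _ : S => (-(t * c)))
    rw [← Matrix.smul_one_eq_diagonal] at this
    rw [this, Pi.exp_def]
    ext i j
    by_cases hij : i = j <;> simp [Matrix.diagonal, hij, Real.exp_eq_exp_ℝ]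
  rw [e, Matrix.exp_add_of_commute _ _ ((Commute.one_right _).smul_right _), e2]
  simp only [mul_smul_comm, mul_one, Matrix.smul_apply, smul_eq_mul]
  refine mul_nonneg (Real.exp_pos _).le (exp_apply_nonneg_of_nonneg _ (fun a b => ?_) x y)
  simp only [Matrix.smul_apply, Matrix.add_apply, smul_eq_mul]
  refine mul_nonneg ht ?_
  by_cases hab : a = b
  · subst hab; simpa using hcz a
  · simpa [Matrix.one_apply, hab] using h a b hab

/-- A Q-matrix: nonnegative off-diagonal entries, and rows summing to zero. -/
structure IsQMatrix (Q : Matrix S S ℝ) : Prop where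
  nonneg : ∀ x y, x ≠ y → 0 ≤ Q x y
  row_sum : ∀ x, ∑ y, Q x y = 0

theorem semigroup_mono {Q : Matrix S S ℝ} (h : IsQMatrix Q) {t : ℝ} (ht : 0 ≤ t) {f g : S → ℝ}
    (hfg : ∀ x, f x ≤ g x) (x : S) : semigroup Q t f x ≤ semigroup Q t g x :=
  Finset.sum_le_sum fun y _ =>
    mul_le_mul_of_nonneg_left (hfg y) (exp_apply_nonneg Q h.nonneg ht x y)

theorem semigroup_le {Q : Matrix S S ℝ} (h : IsQMatrix Q) {t : ℝ} (ht : 0 ≤ t) {f : S → ℝ}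
    {c : ℝ} (hf : ∀ x, f x ≤ c) (x : S) : semigroup Q t f x ≤ c := by
  have := semigroup_mono h ht (g := fun _ => c) hf x
  rwa [semigroup_const Q h.row_sum] at this

theorem le_semigroup {Q : Matrix S S ℝ} (h : IsQMatrix Q) {t : ℝ} (ht : 0 ≤ t) {f : S → ℝ}
    {c : ℝ} (hf : ∀ x, c ≤ f x) (x : S) : c ≤ semigroup Q t f x := by
  have := semigroup_mono h ht (f := fun _ => c) hf x
  rwa [semigroup_const Q h.row_sum] at this

theorem abs_semigroup_le {Q : Matrix S S ℝ} (h : IsQMatrix Q) {t : ℝ} (ht : 0 ≤ t) {f : S → ℝ}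
    {c : ℝ} (hf : ∀ x, |f x| ≤ c) (x : S) : |semigroup Q t f x| ≤ c :=
  abs_le.2 ⟨le_semigroup h ht (fun x => (abs_le.1 (hf x)).1) x,
    semigroup_le h ht (fun x => (abs_le.1 (hf x)).2) x⟩

theorem abs_semigroup_le_semigroup {Q : Matrix S S ℝ} (h : IsQMatrix Q) {t : ℝ} (ht : 0 ≤ t)
    {f g : S → ℝ} (hf : ∀ x, |f x| ≤ g x) (x : S) :
    |semigroup Q t f x| ≤ semigroup Q t g x := by
  refine abs_le.2 ⟨?_, semigroup_mono h ht (fun x => (abs_le.1 (hf x)).2) x⟩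
  have := semigroup_mono h ht (f := (-1 : ℝ) • g) (g := f)
    (fun x => by simpa using (abs_le.1 (hf x)).1) x
  rw [semigroup_smul_fun] at this
  simpa using this

theorem abs_semigroup_sub_le {Q : Matrix S S ℝ} (h : IsQMatrix Q) {t : ℝ} (ht : 0 ≤ t)
    {f : S → ℝ} {c : ℝ} (hf : ∀ x y, |f x - f y| ≤ c) (x y : S) :
    |semigroup Q t f x - semigroup Q t f y| ≤ c := by
  have h1 : ∀ z, |f z - semigroup Q t f x| ≤ c := fun z => by
    have := abs_semigroup_le h ht (f := f - fun _ => f z) (fun w => hf w z) x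
    rw [semigroup_sub_fun, semigroup_const Q h.row_sum] at this
    rwa [abs_sub_comm]
  have := abs_semigroup_le h ht (f := f - fun _ => semigroup Q t f x) h1 y
  rw [semigroup_sub_fun, semigroup_const Q h.row_sum] at this
  rwa [abs_sub_comm]

/-- The chain is still at `x` if it has not jumped, which has probability `exp (t Q x x)`.
Analytically, `exp (-u Q x x)` times the return probability is nondecreasing, its derivative being
the inflow from other states. -/
theorem one_add_le_exp_apply_self {Q : Matrix S S ℝ} (h : IsQMatrix Q) {t : ℝ} (ht : 0 ≤ t)
    (x : S) : 1 + t * Q x x ≤ NormedSpace.exp (t • Q) x x := by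
  have hd : ∀ s, HasDerivAt (fun u => Real.exp (-(Q x x) * u) * NormedSpace.exp (u • Q) x x)
      (Real.exp (-(Q x x) * s) * ((NormedSpace.exp (s • Q) * Q) x x
        - NormedSpace.exp (s • Q) x x * Q x x)) s := fun s => by
    have h1 : HasDerivAt (fun u => Real.exp (-(Q x x) * u))
        (Real.exp (-(Q x x) * s) * -(Q x x)) s := by
      simpa using ((hasDerivAt_id s).const_mul (-(Q x x))).exp
    exact (h1.mul (hasDerivAt_exp_apply Q s x x)).congr_deriv (by ring)
  have hm : MonotoneOn (fun u => Real.exp (-(Q x x) * u) * NormedSpace.exp (u • Q) x x)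
      (Set.Ici 0) := by
    refine monotoneOn_of_deriv_nonneg (convex_Ici 0)
      (fun s _ => (hd s).continuousAt.continuousWithinAt)
      (fun s _ => (hd s).differentiableAt.differentiableWithinAt) fun s hs => ?_
    rw [interior_Ici] at hs
    rw [(hd s).deriv]
    refine mul_nonneg (Real.exp_pos _).le ?_
    rw [Matrix.mul_apply, ← Finset.add_sum_erase _ _ (Finset.mem_univ x), add_sub_cancel_left]
    exact Finset.sum_nonneg fun z hz =>
      mul_nonneg (exp_apply_nonneg Q h.nonneg (le_of_lt hs) x z)
        (h.nonneg z x (Finset.ne_of_mem_erase hz))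
  have := hm (Set.mem_Ici.2 le_rfl) (Set.mem_Ici.2 ht) ht
  simp only [mul_zero, Real.exp_zero, zero_smul, NormedSpace.exp_zero, Matrix.one_apply_eq,
    one_mul] at this
  have h2 : Real.exp (Q x x * t) ≤ NormedSpace.exp (t • Q) x x := by
    have h3 := mul_le_mul_of_nonneg_left this (Real.exp_pos (Q x x * t)).le
    rw [← mul_assoc, ← Real.exp_add] at h3
    simpa using h3
  have := Real.add_one_le_exp (Q x x * t)
  linarith

theorem law_eq_semigroup (Q : Matrix S S ℝ) (t : ℝ) (x : S) (h : S → ℝ) :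
    ∑ y, law Q t x y * h y = semigroup Q t h x := rfl

/-! ### Spectral gap and Poincaré inequality -/

theorem le_spectralGap_iff {S : Type*} [Fintype S] {Q : Matrix S S ℝ} {γ : ℝ} (hγ : 0 < γ) :
    ENNReal.ofReal γ ≤ spectralGap Q (uniform S) ↔
      ∀ (l : ℝ) (f : S → ℝ), f ≠ 0 → ∑ x, f x = 0 → Q *ᵥ f = (-l) • f → γ ≤ l := by
  simp only [spectralGap, le_iInf_iff]
  have hs : ∀ f : S → ℝ, f ≠ 0 → (∑ x, uniform S x * f x = 0 ↔ ∑ x, f x = 0) := fun f hf => by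
    have : Nonempty S := by
      by_contra hS
      exact hf (funext fun x => (hS ⟨x⟩).elim)
    simp [uniform, ← Finset.mul_sum]
  have he : ∀ (l : ℝ) (f : S → ℝ), (-Q).mulVec f = l • f ↔ Q *ᵥ f = (-l) • f := fun l f => by
    rw [Matrix.neg_mulVec, neg_smul, neg_eq_iff_eq_neg]
  constructor
  · intro h l f hf h0 h1
    have := h l ⟨f, hf, (hs f hf).2 h0, (he l f).2 h1⟩
    by_contra hl
    push Not at hl
    exact absurd this (not_le.2 ((ENNReal.ofReal_lt_ofReal_iff hγ).2 hl))
  · rintro h l ⟨f, hf, h0, h1⟩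
    exact ENNReal.ofReal_le_ofReal (h l f hf ((hs f hf).1 h0) ((he l f).1 h1))

theorem poincare_of_le_spectralGap {Q : Matrix S S ℝ} (hQ : Q.IsSymm)
    (hrow : ∀ x, ∑ y, Q x y = 0) {γ : ℝ} (hγ : 0 < γ)
    (hgap : ENNReal.ofReal γ ≤ spectralGap Q (uniform S)) (f : S → ℝ) (hf : ∑ x, f x = 0) :
    γ * ∑ x, f x ^ 2 ≤ - ∑ x, f x * (Q *ᵥ f) x := by
  rw [le_spectralGap_iff hγ] at hgap
  set n : ℝ := (Fintype.card S : ℝ)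
  -- The inequality follows from `N ≥ 0`. The rank-one term makes `N` kill the constants, so an
  -- eigenvector of `N` has eigenvalue zero or sum zero; in the latter case it is an eigenvector of
  -- `-Q`, with eigenvalue larger by `γ`.
  set N : Matrix S S ℝ := -Q + Matrix.of (fun _ _ => γ / n) - γ • 1 with hN
  have hNm : ∀ (g : S → ℝ) x, (N *ᵥ g) x = -(Q *ᵥ g) x + γ / n * ∑ y, g y - γ * g x := by
    intro g x
    simp only [hN, Matrix.sub_mulVec, Matrix.add_mulVec, Matrix.neg_mulVec, Matrix.smul_mulVec,
      Matrix.one_mulVec, Pi.sub_apply, Pi.add_apply, Pi.neg_apply, Pi.smul_apply, smul_eq_mul]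
    congr 2
    simp [Matrix.mulVec, dotProduct, Finset.mul_sum]
  have hsumQ : ∀ g : S → ℝ, ∑ x, (Q *ᵥ g) x = 0 := fun g => by
    simp only [Matrix.mulVec, dotProduct]
    rw [Finset.sum_comm]
    refine Finset.sum_eq_zero fun y _ => ?_
    rw [← Finset.sum_mul]
    have : ∑ x, Q x y = 0 := by rw [← hrow y]; exact Finset.sum_congr rfl fun x _ => hQ.apply y x
    rw [this, zero_mul]
  have hherm : N.IsHermitian := by
    ext x y
    have := hQ.apply x y
    simp [hN, Matrix.one_apply, this, eq_comm]
  have hpsd : N.PosSemidef := by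
    rw [hherm.posSemidef_iff_eigenvalues_nonneg]
    intro j
    have hev := hherm.mulVec_eigenvectorBasis j
    set φ := (hherm.eigenvectorBasis j).ofLp with hφ
    set ν := hherm.eigenvalues j
    have hφ0 : φ ≠ 0 := fun h0 => by
      have h1 := hherm.eigenvectorBasis.orthonormal.ne_zero j
      apply h1
      ext x
      exact congrFun h0 x
    have hne : n ≠ 0 := by
      have : Nonempty S := ⟨j⟩
      simp [n]
    have hsum : ∑ x, (N *ᵥ φ) x = 0 := by
      simp only [hNm, Finset.sum_sub_distrib, Finset.sum_add_distrib, Finset.sum_neg_distrib,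
        hsumQ, Finset.sum_const, Finset.card_univ, nsmul_eq_mul, ← Finset.mul_sum]
      change -0 + n * _ - _ = _
      field_simp
      ring
    rw [hev] at hsum
    simp only [Pi.smul_apply, smul_eq_mul, ← Finset.mul_sum, mul_eq_zero] at hsum
    rcases hsum with h | h
    · exact h.ge
    · have := hgap (ν + γ) φ hφ0 h (by
        ext x
        have h2 := congrFun hev x
        rw [hNm, h] at h2
        simp only [Pi.smul_apply, smul_eq_mul] at h2 ⊢
        linarith)
      change 0 ≤ ν
      linarith
  have := hpsd.dotProduct_mulVec_nonneg f
  simp only [dotProduct, hNm, hf, star_trivial] at this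
  have e : ∑ x, f x * (-(Q *ᵥ f) x + γ / n * 0 - γ * f x)
      = - ∑ x, f x * (Q *ᵥ f) x - γ * ∑ x, f x ^ 2 := by
    rw [Finset.mul_sum, ← Finset.sum_neg_distrib, ← Finset.sum_sub_distrib]
    exact Finset.sum_congr rfl fun x _ => by ring
  linarith

theorem sum_semigroup {Q : Matrix S S ℝ} (hQ : Q.IsSymm) (hrow : ∀ x, ∑ y, Q x y = 0) (t : ℝ)
    (f : S → ℝ) : ∑ x, semigroup Q t f x = ∑ x, f x := by
  have hE : (NormedSpace.exp (t • Q)).IsSymm := by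
    have : (NormedSpace.exp (t • Q))ᵀ = NormedSpace.exp (t • Q) := by
      rw [← Matrix.exp_transpose, Matrix.transpose_smul, hQ.eq]
    exact this
  have h1 := semigroup_const Q hrow t 1
  simp only [semigroup, Matrix.mulVec, dotProduct] at h1 ⊢
  rw [Finset.sum_comm]
  refine Finset.sum_congr rfl fun y _ => ?_
  rw [← Finset.sum_mul]
  have h2 : ∑ x, NormedSpace.exp (t • Q) x y = 1 := by
    rw [← congrFun h1 y]
    exact Finset.sum_congr rfl fun x _ => (hE.apply y x).trans (mul_one _).symm
  rw [h2, one_mul]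

theorem sum_sq_semigroup_le {Q : Matrix S S ℝ} (hQ : Q.IsSymm)
    (hrow : ∀ x, ∑ y, Q x y = 0) {γ : ℝ} (hγ : 0 < γ)
    (hgap : ENNReal.ofReal γ ≤ spectralGap Q (uniform S)) (f : S → ℝ) (hf : ∑ x, f x = 0)
    {t : ℝ} (ht : 0 ≤ t) :
    ∑ x, semigroup Q t f x ^ 2 ≤ Real.exp (-(2 * γ * t)) * ∑ x, f x ^ 2 := by
  have hd : ∀ s, HasDerivAt (fun u => Real.exp (2 * γ * u) * ∑ x, semigroup Q u f x ^ 2)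
      (Real.exp (2 * γ * s) * (2 * γ) * ∑ x, semigroup Q s f x ^ 2 + Real.exp (2 * γ * s) *
        ∑ x, 2 * semigroup Q s f x * (Q *ᵥ semigroup Q s f) x) s := fun s => by
    have h1 : HasDerivAt (fun u => Real.exp (2 * γ * u)) (Real.exp (2 * γ * s) * (2 * γ)) s := by
      simpa using ((hasDerivAt_id s).const_mul (2 * γ)).exp
    have h2 := HasDerivAt.fun_sum (u := Finset.univ)
      fun x _ => (hasDerivAt_semigroup_apply Q f s x).pow 2
    refine h1.mul ?_
    simpa [semigroup_mulVec_comm] using h2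
  have hm : AntitoneOn (fun u => Real.exp (2 * γ * u) * ∑ x, semigroup Q u f x ^ 2)
      (Set.Ici 0) := by
    refine antitoneOn_of_deriv_nonpos (convex_Ici 0)
      (fun s _ => (hd s).continuousAt.continuousWithinAt)
      (fun s _ => (hd s).differentiableAt.differentiableWithinAt) fun s _ => ?_
    rw [(hd s).deriv, mul_assoc, ← mul_add]
    refine mul_nonpos_of_nonneg_of_nonpos (Real.exp_pos _).le ?_
    have := poincare_of_le_spectralGap hQ hrow hγ hgap (semigroup Q s f)
      (by rw [sum_semigroup hQ hrow, hf])
    simp only [mul_assoc, ← Finset.mul_sum]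
    linarith
  have := hm (Set.mem_Ici.2 le_rfl) (Set.mem_Ici.2 ht) ht
  simp only [mul_zero, Real.exp_zero, one_mul, semigroup_zero] at this
  have h3 := mul_le_mul_of_nonneg_left this (Real.exp_pos (-(2 * γ * t))).le
  rw [← mul_assoc, ← Real.exp_add] at h3
  simpa using h3

/-- The centred point mass at `y` has `ℓ²` norm at most 1, the semigroup contracts it at rate `γ`,
and one entry is at most the norm. -/
theorem abs_exp_apply_sub_le {Q : Matrix S S ℝ} (hQ : Q.IsSymm)
    (hrow : ∀ x, ∑ y, Q x y = 0) {γ : ℝ} (hγ : 0 < γ)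
    (hgap : ENNReal.ofReal γ ≤ spectralGap Q (uniform S)) {t : ℝ} (ht : 0 ≤ t) (x y : S) :
    |NormedSpace.exp (t • Q) x y - 1 / Fintype.card S| ≤ Real.exp (-(γ * t)) := by
  have hn : (0 : ℝ) < Fintype.card S := by
    have : Nonempty S := ⟨x⟩
    exact_mod_cast Fintype.card_pos
  set c : ℝ := 1 / Fintype.card S with hc
  have hnc : (Fintype.card S : ℝ) * c = 1 := by rw [hc]; field_simp
  set f : S → ℝ := Pi.single y 1 - fun _ => c with hf
  have hf0 : ∑ z, f z = 0 := by simp [hf, hnc]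
  have hf2 : ∑ z, f z ^ 2 ≤ 1 := by
    have : ∑ z, f z ^ 2 = 1 - c := by
      have e : ∀ z, f z ^ 2 = (Pi.single y 1 : S → ℝ) z * (1 - 2 * c) + c ^ 2 := fun z => by
        by_cases h : z = y
        · subst h; simp [hf]; ring
        · simp [hf, h]
      simp only [e, Finset.sum_add_distrib, ← Finset.sum_mul]
      simp only [Finset.sum_pi_single', Finset.mem_univ, if_true, Finset.sum_const,
        Finset.card_univ, nsmul_eq_mul]
      linear_combination c * hnc
    rw [this]
    have : 0 < c := by positivity
    linarith
  have h1 := sum_sq_semigroup_le hQ hrow hγ hgap f hf0 ht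
  have h2 : semigroup Q t f x = NormedSpace.exp (t • Q) x y - c := by
    rw [hf, semigroup_sub_fun, semigroup_const Q hrow]
    simp [semigroup]
  have h3 := Finset.single_le_sum (f := fun z => semigroup Q t f z ^ 2)
    (fun z _ => sq_nonneg _) (Finset.mem_univ x)
  simp only [h2] at h3
  refine abs_le_of_sq_le_sq (h3.trans (h1.trans ?_)) (Real.exp_pos _).le
  calc _ ≤ Real.exp (-(2 * γ * t)) * 1 := mul_le_mul_of_nonneg_left hf2 (Real.exp_pos _).le
    _ = _ := by rw [mul_one, sq, ← Real.exp_add]; ring_nf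

end MarkovChain

end

/-! ### Averages over a hyperedge and the Dirichlet form. -/

noncomputable section

open scoped Matrix

namespace RatedHypergraph

section EdgeAverage

variable {V : Type u} [DecidableEq V] {S S' : Type*} [MulAction (Perm V) S] [MulAction (Perm V) S']

/-- The average of `f (σ • x)` over the permutations `σ` of `e`. -/
def edgeAvg (e : Finset V) (f : S → ℝ) (x : S) : ℝ :=
  (∑ σ : Perm {v // v ∈ e}, f (Perm.ofSubtype σ • x)) / (e.card.factorial : ℝ)

theorem edgeAvg_eq_of_forall {e : Finset V} {f : S → ℝ} {x : S} {c : ℝ}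
    (h : ∀ σ : Perm {v // v ∈ e}, f (Perm.ofSubtype σ • x) = c) : edgeAvg e f x = c := by
  have : (e.card.factorial : ℝ) ≠ 0 := by positivity
  simp only [edgeAvg, h, Finset.sum_const, Finset.card_univ, Fintype.card_perm,
    Fintype.card_coe, nsmul_eq_mul]
  field_simp

theorem edgeAvg_const (e : Finset V) (c : ℝ) (x : S) : edgeAvg e (fun _ => c) x = c :=
  edgeAvg_eq_of_forall fun _ => rfl

theorem edgeAvg_comp (e : Finset V) (π : S → S') (hπ : ∀ (σ : Perm V) x, π (σ • x) = σ • π x)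
    (f : S' → ℝ) (x : S) : edgeAvg e (f ∘ π) x = edgeAvg e f (π x) := by
  simp only [edgeAvg, Function.comp_apply, hπ]

theorem edgeAvg_sub (e : Finset V) (f g : S → ℝ) (x : S) :
    edgeAvg e (f - g) x = edgeAvg e f x - edgeAvg e g x := by
  simp only [edgeAvg, Pi.sub_apply, Finset.sum_sub_distrib, sub_div]

theorem abs_edgeAvg_le {e : Finset V} {f : S → ℝ} {x : S} {c : ℝ}
    (h : ∀ σ : Perm {v // v ∈ e}, |f (Perm.ofSubtype σ • x)| ≤ c) : |edgeAvg e f x| ≤ c := by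
  have h0 : (0 : ℝ) < (e.card.factorial : ℝ) := by positivity
  rw [edgeAvg, abs_div, abs_of_pos h0, div_le_iff₀ h0]
  refine (Finset.abs_sum_le_sum_abs _ _).trans ((Finset.sum_le_sum fun σ _ => h σ).trans ?_)
  simp [Finset.card_univ, Fintype.card_perm, mul_comm]

/-- Averaging over `e` is invariant under the permutations of `e`. -/
theorem edgeAvg_smul (e : Finset V) (f : S → ℝ) (x : S) (τ : Perm {v // v ∈ e}) :
    edgeAvg e f (Perm.ofSubtype τ • x) = edgeAvg e f x := by
  unfold edgeAvg
  congr 1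
  refine Fintype.sum_equiv (Equiv.mulRight τ) _ _ fun σ => ?_
  simp [mul_smul]

theorem edgeAvg_edgeAvg (e : Finset V) (f : S → ℝ) (x : S) :
    edgeAvg e (edgeAvg e f) x = edgeAvg e f x :=
  edgeAvg_eq_of_forall fun σ => edgeAvg_smul e f x σ

theorem sum_mul_edgeAvg [Fintype S] (e : Finset V) (f g : S → ℝ) :
    ∑ x, f x * edgeAvg e g x = ∑ x, edgeAvg e f x * g x := by
  simp only [edgeAvg, mul_div_assoc', div_mul_eq_mul_div, ← Finset.sum_div, Finset.mul_sum,
    Finset.sum_mul]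
  congr 1
  rw [Finset.sum_comm, Finset.sum_comm (s := (Finset.univ : Finset S))]
  refine Fintype.sum_equiv (Equiv.inv _) _ _ fun σ => ?_
  refine Fintype.sum_equiv (MulAction.toPerm (Perm.ofSubtype σ)) _ _ fun x => ?_
  simp

/-- `edgeAvg e` is self-adjoint and idempotent, hence an orthogonal projection. -/
theorem sum_edgeAvg_mul_sub [Fintype S] (e : Finset V) (f : S → ℝ) :
    ∑ x, edgeAvg e f x * (f x - edgeAvg e f x) = 0 := by
  simp only [mul_sub, Finset.sum_sub_distrib]
  rw [sum_mul_edgeAvg e (edgeAvg e f) f]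
  simp only [edgeAvg_edgeAvg, sub_self]

theorem sum_mul_sub_edgeAvg [Fintype S] (e : Finset V) (f : S → ℝ) :
    ∑ x, f x * (f x - edgeAvg e f x) = ∑ x, (f x - edgeAvg e f x) ^ 2 := by
  have h := sum_edgeAvg_mul_sub e f
  rw [← sub_eq_zero, ← Finset.sum_sub_distrib, ← h]
  exact Finset.sum_congr rfl fun x _ => by ring

end EdgeAverage

section Generator

variable {V : Type u} [DecidableEq V] (H : RatedHypergraph V)
  {S S' : Type u} [Fintype S] [DecidableEq S] [Fintype S'] [DecidableEq S']
  [MulAction (Perm V) S] [MulAction (Perm V) S']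

theorem generator_mulVec (f : S → ℝ) (x : S) :
    (H.generator S *ᵥ f) x = ∑ e ∈ H.edges, H.rate e * (edgeAvg e f x - f x) := by
  simp only [generator, Matrix.mulVec, dotProduct, Matrix.of_apply, Finset.sum_mul]
  rw [Finset.sum_comm]
  refine Finset.sum_congr rfl fun e _ => ?_
  simp only [mul_assoc, sub_mul, ← Finset.mul_sum, Finset.sum_sub_distrib, edgeAvg]
  congr 2
  · simp only [div_mul_eq_mul_div, ← Finset.sum_div, Finset.sum_mul]
    rw [Finset.sum_comm]
    simp
  · simp

theorem generator_isQMatrix : MarkovChain.IsQMatrix (H.generator S) where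
  nonneg x y hxy := by
    simp only [generator, Matrix.of_apply, hxy, if_false, sub_zero]
    refine Finset.sum_nonneg fun e he => mul_nonneg (H.rate_pos e he).le ?_
    refine div_nonneg (Finset.sum_nonneg fun σ _ => ?_) (by positivity)
    split_ifs <;> norm_num
  row_sum := H.generator_row_sum S

theorem generator_intertwine (π : S → S') (hπ : ∀ (σ : Perm V) x, π (σ • x) = σ • π x)
    (g : S' → ℝ) : H.generator S *ᵥ (g ∘ π) = (H.generator S' *ᵥ g) ∘ π := by
  ext x
  simp only [generator_mulVec, Function.comp_apply, edgeAvg_comp _ π hπ]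

theorem semigroup_comp (π : S → S') (hπ : ∀ (σ : Perm V) x, π (σ • x) = σ • π x) (t : ℝ)
    (g : S' → ℝ) : MarkovChain.semigroup (H.generator S) t (g ∘ π)
      = MarkovChain.semigroup (H.generator S') t g ∘ π :=
  MarkovChain.semigroup_intertwine _ _ π (H.generator_intertwine π hπ) t g

/-- The Dirichlet form. -/
theorem neg_sum_mul_generator_mulVec (f : S → ℝ) :
    -∑ x, f x * (H.generator S *ᵥ f) x
      = ∑ e ∈ H.edges, H.rate e * ∑ x, (f x - edgeAvg e f x) ^ 2 := by
  simp only [generator_mulVec, Finset.mul_sum]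
  rw [Finset.sum_comm, ← Finset.sum_neg_distrib]
  refine Finset.sum_congr rfl fun e _ => ?_
  rw [← Finset.mul_sum (s := Finset.univ), ← sum_mul_sub_edgeAvg, Finset.mul_sum,
    ← Finset.sum_neg_distrib]
  exact Finset.sum_congr rfl fun x _ => by ring

end Generator

section EdgePerm

variable {V : Type u} [DecidableEq V] {e : Finset V}

theorem ofSubtype_apply_mem (σ : Perm {v // v ∈ e}) {x : V} (hx : x ∈ e) :
    Perm.ofSubtype σ x ∈ e := by
  rw [Perm.ofSubtype_apply_of_mem σ hx]
  exact (σ ⟨x, hx⟩).2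

theorem ofSubtype_apply_of_notMem (σ : Perm {v // v ∈ e}) {x : V} (hx : x ∉ e) :
    Perm.ofSubtype σ x = x := Perm.ofSubtype_apply_of_not_mem σ hx

theorem exists_ofSubtype_apply {x x' : V} (hx : x ∈ e) (hx' : x' ∈ e) :
    ∃ σ : Perm {v // v ∈ e}, Perm.ofSubtype σ x = x' :=
  ⟨swap ⟨x, hx⟩ ⟨x', hx'⟩, by rw [Perm.ofSubtype_apply_of_mem _ hx]; simp⟩

theorem exists_ofSubtype_apply₂ {x y x' y' : V} (hx : x ∈ e) (hy : y ∈ e) (hxy : x ≠ y)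
    (hx' : x' ∈ e) (hy' : y' ∈ e) (hxy' : x' ≠ y') :
    ∃ σ : Perm {v // v ∈ e}, Perm.ofSubtype σ x = x' ∧ Perm.ofSubtype σ y = y' := by
  have key : ∀ {a b c d : {v // v ∈ e}}, a ≠ b → c ≠ d →
      ∃ g : Perm {v // v ∈ e}, g • a = c ∧ g • b = d :=
    MulAction.is_two_pretransitive_iff.1 (Equiv.Perm.isMultiplyPretransitive {v // v ∈ e} 2)
  obtain ⟨σ, h1, h2⟩ := key (a := ⟨x, hx⟩) (b := ⟨y, hy⟩) (c := ⟨x', hx'⟩)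
    (d := ⟨y', hy'⟩) (by simpa using hxy) (by simpa using hxy')
  refine ⟨σ, ?_, ?_⟩
  · rw [Perm.ofSubtype_apply_of_mem _ hx]; exact congrArg Subtype.val h1
  · rw [Perm.ofSubtype_apply_of_mem _ hy]; exact congrArg Subtype.val h2

end EdgePerm

end RatedHypergraph

end

/-! ### A Poincaré inequality for functions of two vertices. -/

noncomputable section

open scoped Matrix

/-- If the numbers `m i` are pairwise close, some `d` is close to all of them on average. -/
theorem Finset.exists_sum_mul_sub_sq_le {ι : Type*} (s : Finset ι) (r m G : ι → ℝ)
    (hr : ∀ i ∈ s, 0 < r i) (h : ∀ i ∈ s, ∀ j ∈ s, (m i - m j) ^ 2 ≤ G i + G j) :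
    ∃ d : ℝ, ∑ i ∈ s, r i * (d - m i) ^ 2 ≤ 2 * ∑ i ∈ s, r i * G i := by
  rcases s.eq_empty_or_nonempty with rfl | hs
  · exact ⟨0, by simp⟩
  -- The choice `d = m j` works for some `j`: averaged over `j` with weights `r j`, the left side
  -- satisfies the bound.
  obtain ⟨j, hj, hle⟩ := Finset.exists_le_of_sum_le hs
    (f := fun j => r j * ∑ i ∈ s, r i * (m j - m i) ^ 2)
    (g := fun j => r j * (2 * ∑ i ∈ s, r i * G i)) (by
      calc ∑ j ∈ s, r j * ∑ i ∈ s, r i * (m j - m i) ^ 2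
          ≤ ∑ j ∈ s, r j * ∑ i ∈ s, r i * (G j + G i) := by
            refine Finset.sum_le_sum fun j hj => mul_le_mul_of_nonneg_left
              (Finset.sum_le_sum fun i hi => mul_le_mul_of_nonneg_left (h j hj i hi) (hr i hi).le)
              (hr j hj).le
        _ = ∑ j ∈ s, r j * (2 * ∑ i ∈ s, r i * G i) := by
            simp only [mul_add, Finset.sum_add_distrib, ← Finset.sum_mul, ← mul_assoc]
            have h1 : ∑ x ∈ s, (r x * ∑ i ∈ s, r i) * G x
                = (∑ i ∈ s, r i) * ∑ i ∈ s, r i * G i := by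
              rw [Finset.mul_sum]
              exact Finset.sum_congr rfl fun x _ => by ring
            rw [h1]
            ring)
  exact ⟨m j, le_of_mul_le_mul_left hle (hr j hj)⟩

namespace RatedHypergraph

variable {V : Type u} [Fintype V] [DecidableEq V]

omit [Fintype V] in
theorem sum_sub_edgeAvg_sq_le {S : Type*} [Fintype S] [MulAction (Perm V) S] (e : Finset V)
    (g : S → ℝ) : ∑ x, (g x - edgeAvg e g x) ^ 2 ≤ ∑ x, g x ^ 2 := by
  have h := sum_edgeAvg_mul_sub e g
  have h2 : ∑ x, g x ^ 2 = ∑ x, (g x - edgeAvg e g x) ^ 2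
      + 2 * ∑ x, edgeAvg e g x * (g x - edgeAvg e g x) + ∑ x, edgeAvg e g x ^ 2 := by
    rw [Finset.mul_sum, ← Finset.sum_add_distrib, ← Finset.sum_add_distrib]
    exact Finset.sum_congr rfl fun x _ => by ring
  have h3 : 0 ≤ ∑ x, edgeAvg e g x ^ 2 := Finset.sum_nonneg fun _ _ => sq_nonneg _
  rw [h2, h]
  linarith

/-- Off `e` the averaging does nothing, and on `e` it commutes with subtracting `c`; the rest is
contraction by a projection. -/
theorem sum_sub_edgeAvg_sq_le_sum_mem (e : Finset V) (h : V → ℝ) (c : ℝ) :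
    ∑ x, (h x - edgeAvg e h x) ^ 2 ≤ ∑ x ∈ e, (h x - c) ^ 2 := by
  set g : V → ℝ := fun x => if x ∈ e then h x - c else 0 with hg
  have h1 : ∀ x, h x - edgeAvg e h x = g x - edgeAvg e g x := fun x => by
    by_cases hx : x ∈ e
    · have : edgeAvg e g x = edgeAvg e (h - fun _ => c) x := by
        unfold edgeAvg
        congr 1
        refine Finset.sum_congr rfl fun σ _ => ?_
        simp [hg, Perm.smul_def, ofSubtype_apply_mem σ hx]
      rw [this, edgeAvg_sub, edgeAvg_const]
      simp [hg, hx]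
    · have h2 : ∀ f : V → ℝ, edgeAvg e f x = f x := fun f =>
        edgeAvg_eq_of_forall fun σ => by rw [Perm.smul_def, ofSubtype_apply_of_notMem σ hx]
      rw [h2, h2, sub_self, sub_self]
  simp only [h1]
  refine (sum_sub_edgeAvg_sq_le e g).trans_eq ?_
  rw [← Finset.sum_filter_add_sum_filter_not Finset.univ (· ∈ e)]
  rw [Finset.sum_eq_zero (s := Finset.univ.filter fun x => ¬ x ∈ e)
    (fun x hx => by simp [hg, (Finset.mem_filter.1 hx).2]), add_zero]
  refine Finset.sum_congr (by ext; simp) fun x hx => by simp [hg, hx]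

section Pairs

variable (F : V × V → ℝ)

/-- The deviation of `F` from its average over `e`. -/
def dev (e : Finset V) (x y : V) : ℝ := F (x, y) - edgeAvg e F (x, y)

/-- The squared deviations over `e` at the pairs containing `y`. -/
def devAt (e : Finset V) (y : V) : ℝ := ∑ w, (dev F e y w ^ 2 + dev F e w y ^ 2)

omit [Fintype V] in
theorem edgeAvg_pair_left {e : Finset V} {x x' y : V} (hx : x ∈ e) (hx' : x' ∈ e) (hy : y ∉ e) :
    edgeAvg e F (x', y) = edgeAvg e F (x, y) := by
  obtain ⟨σ, hσ⟩ := exists_ofSubtype_apply hx hx'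
  rw [← edgeAvg_smul e F (x, y) σ, Prod.smul_mk, Perm.smul_def, Perm.smul_def, hσ,
    ofSubtype_apply_of_notMem σ hy]

omit [Fintype V] in
theorem edgeAvg_pair_right {e : Finset V} {x y y' : V} (hx : x ∉ e) (hy : y ∈ e) (hy' : y' ∈ e) :
    edgeAvg e F (x, y') = edgeAvg e F (x, y) := by
  obtain ⟨σ, hσ⟩ := exists_ofSubtype_apply hy hy'
  rw [← edgeAvg_smul e F (x, y) σ, Prod.smul_mk, Perm.smul_def, Perm.smul_def, hσ,
    ofSubtype_apply_of_notMem σ hx]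

omit [Fintype V] in
theorem exists_edgeAvg_pair_eq (e : Finset V) :
    ∃ m : ℝ, ∀ x ∈ e, ∀ y ∈ e, x ≠ y → edgeAvg e F (x, y) = m := by
  by_cases h : ∃ x ∈ e, ∃ y ∈ e, x ≠ y
  · obtain ⟨x, hx, y, hy, hxy⟩ := h
    refine ⟨edgeAvg e F (x, y), fun x' hx' y' hy' hxy' => ?_⟩
    obtain ⟨σ, h1, h2⟩ := exists_ofSubtype_apply₂ hx hy hxy hx' hy' hxy'
    rw [← edgeAvg_smul e F (x, y) σ, Prod.smul_mk, Perm.smul_def, Perm.smul_def, h1, h2]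
  · push Not at h
    exact ⟨0, fun x hx y hy hxy => absurd (h x hx y hy) hxy⟩

theorem dev_left_sq_le (e : Finset V) (x y : V) : dev F e x y ^ 2 ≤ devAt F e x :=
  (le_add_of_nonneg_right (sq_nonneg _)).trans (Finset.single_le_sum
    (f := fun w => dev F e x w ^ 2 + dev F e w x ^ 2) (fun _ _ => by positivity)
    (Finset.mem_univ y))

theorem dev_right_sq_le (e : Finset V) (x y : V) : dev F e x y ^ 2 ≤ devAt F e y :=
  (le_add_of_nonneg_left (sq_nonneg _)).trans (Finset.single_le_sum
    (f := fun w => dev F e y w ^ 2 + dev F e w y ^ 2) (fun _ _ => by positivity)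
    (Finset.mem_univ x))

theorem devAt_nonneg (e : Finset V) (y : V) : 0 ≤ devAt F e y :=
  Finset.sum_nonneg fun _ _ => by positivity

theorem sum_devAt (e : Finset V) :
    ∑ y, devAt F e y = 2 * ∑ p, (F p - edgeAvg e F p) ^ 2 := by
  simp only [devAt, Finset.sum_add_distrib, Fintype.sum_prod_type, two_mul, dev]
  rw [Finset.sum_comm (f := fun y w => (F (w, y) - edgeAvg e F (w, y)) ^ 2)]

/-- The averages of `F` over the pairs in two edges through `y` are close. -/
theorem edgeMean_sub_sq_le {m : Finset V → ℝ}
    (hm : ∀ e, ∀ x ∈ e, ∀ y ∈ e, x ≠ y → edgeAvg e F (x, y) = m e)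
    {e e' : Finset V} {y a b : V} (hy : y ∈ e) (hy' : y ∈ e') (ha : a ∈ e) (hay : a ≠ y)
    (hb : b ∈ e') (hby : b ≠ y) :
    (m e - m e') ^ 2 ≤ 6 * (2 * devAt F e y + devAt F e a)
      + 6 * (2 * devAt F e' y + devAt F e' b) := by
  have n1 := devAt_nonneg F e y
  have n2 := devAt_nonneg F e a
  have n3 := devAt_nonneg F e' y
  have n4 := devAt_nonneg F e' b
  by_cases hc : ∃ c ∈ e, c ∈ e' ∧ c ≠ y
  -- A second common vertex `c` lets both averages be compared with the single value `F (y, c)`.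
  · obtain ⟨c, hc, hc', hcy⟩ := hc
    have h1 := hm e y hy c hc hcy.symm
    have h2 := hm e' y hy' c hc' hcy.symm
    have b1 := dev_left_sq_le F e y c
    have b2 := dev_left_sq_le F e' y c
    have : m e - m e' = dev F e' y c - dev F e y c := by simp only [dev]; rw [h1, h2]; ring
    rw [this]
    nlinarith [sq_nonneg (dev F e' y c + dev F e y c)]
  · push Not at hc
    have ha' : a ∉ e' := fun h => hay (hc a ha h)
    have hb' : b ∉ e := fun h => hby (hc b h hb)
    have h1 := hm e y hy a ha hay.symm
    have h2 := hm e' b hb y hy' hby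
    have h3 := edgeAvg_pair_left F hb hy' ha'
    have h4 := edgeAvg_pair_right F hb' hy ha
    have b1 := dev_left_sq_le F e y a
    have b2 := dev_left_sq_le F e' y a
    have b3 := dev_left_sq_le F e' b a
    have b4 := dev_right_sq_le F e b a
    have b5 := dev_right_sq_le F e b y
    have b6 := dev_right_sq_le F e' b y
    -- Route from `m e` to `m e'` through `F (y, a)`, `F (b, a)` and `F (b, y)`. Since `a ∉ e'`, the
    -- average over `e'` is the same at `(y, a)` and `(b, a)`; since `b ∉ e`, the average over `e`
    -- is the same at `(b, a)` and `(b, y)`.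
    have : m e - m e' = (-dev F e y a) + dev F e' y a + (-dev F e' b a) + dev F e b a
        + (-dev F e b y) + dev F e' b y := by
      simp only [dev]; rw [h1, h2, h3, h4]; ring
    rw [this]
    have key : ∀ p q r s t u : ℝ, (p + q + r + s + t + u) ^ 2
        ≤ 6 * (p ^ 2 + q ^ 2 + r ^ 2 + s ^ 2 + t ^ 2 + u ^ 2) := fun p q r s t u => by
      have := sq_sum_le_card_mul_sum_sq (s := Finset.univ) (f := ![p, q, r, s, t, u])
      simpa [Fin.sum_univ_succ, add_assoc] using this
    refine (key _ _ _ _ _ _).trans ?_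
    simp only [neg_sq]
    linarith

/-- Each section `F (·, y)` is treated as a single-particle function, its irrelevant value on the
diagonal being chosen to suit the edges through `y`. -/
theorem pair_poincare (H : RatedHypergraph V) {γ : ℝ}
    (hP : ∀ h : V → ℝ, ∑ x, h x = 0 →
      γ * ∑ x, h x ^ 2 ≤ ∑ e ∈ H.edges, H.rate e * ∑ x, (h x - edgeAvg e h x) ^ 2)
    (hγ : 0 ≤ γ) (hmarg : ∀ y, ∑ x, F (x, y) = 0) (hdiag : ∀ x, F (x, x) = 0) :
    γ * ∑ p, F p ^ 2
      ≤ 73 * ∑ e ∈ H.edges, H.rate e * ∑ p, (F p - edgeAvg e F p) ^ 2 := by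
  choose m hm using exists_edgeAvg_pair_eq F
  -- A cyclic permutation of each edge supplies the auxiliary vertex `a = c e y ≠ y` of the
  -- comparison of averages; being a bijection, it disappears when summing over `y`.
  choose c hc _ using fun e : Finset V => e.exists_cycleOn
  set G : Finset V → V → ℝ := fun e y => 6 * (2 * devAt F e y + devAt F e (c e y)) with hG
  set E : V → Finset (Finset V) := fun y => H.edges.filter fun e => y ∈ e ∧ e.Nontrivial with hE
  have hEmem : ∀ {y e}, e ∈ E y ↔ e ∈ H.edges ∧ y ∈ e ∧ e.Nontrivial := by simp [hE]
  have hd : ∀ y, ∃ d : ℝ, ∑ e ∈ E y, H.rate e * (d - m e) ^ 2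
      ≤ 2 * ∑ e ∈ E y, H.rate e * G e y := fun y => by
    refine (E y).exists_sum_mul_sub_sq_le H.rate m (fun e => G e y)
      (fun e he => H.rate_pos e (hEmem.1 he).1) fun e he e' he' => ?_
    obtain ⟨-, hy, hnt⟩ := hEmem.1 he
    obtain ⟨-, hy', hnt'⟩ := hEmem.1 he'
    exact edgeMean_sub_sq_le F hm hy hy' ((hc e).1.mapsTo hy) ((hc e).apply_ne hnt hy)
      ((hc e').1.mapsTo hy') ((hc e').apply_ne hnt' hy')
  choose d hd using hd
  have hrow : ∀ y, γ * ∑ x, F (x, y) ^ 2 ≤ ∑ e ∈ H.edges, H.rate e * ∑ x, dev F e x y ^ 2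
      + ∑ e ∈ E y, H.rate e * (d y - m e) ^ 2 := fun y => by
    set h : V → ℝ := fun x => if x = y then d y else F (x, y) with hh
    have hhx : ∀ x, x ≠ y → h x = F (x, y) := fun x hx => by simp [hh, hx]
    have hhy : h y = d y := by simp [hh]
    have hsF : ∑ x ∈ Finset.univ.erase y, F (x, y) = 0 := by
      have := Finset.add_sum_erase Finset.univ (fun x => F (x, y)) (Finset.mem_univ y)
      rwa [hdiag, hmarg, zero_add] at this
    have hsF2 : ∑ x ∈ Finset.univ.erase y, F (x, y) ^ 2 = ∑ x, F (x, y) ^ 2 := by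
      have := Finset.add_sum_erase Finset.univ (fun x => F (x, y) ^ 2) (Finset.mem_univ y)
      rwa [hdiag, zero_pow two_ne_zero, zero_add] at this
    set μ : ℝ := (∑ x, h x) / Fintype.card V with hμ
    have hn : (Fintype.card V : ℝ) ≠ 0 := by
      have : Nonempty V := ⟨y⟩
      simp
    obtain ⟨g, hg⟩ : ∃ g : V → ℝ, g = h - fun _ => μ := ⟨_, rfl⟩
    have hgx : ∀ x, g x = h x - μ := fun x => by rw [hg, Pi.sub_apply]
    have h0 : ∑ x, g x = 0 := by
      simp only [hgx, Finset.sum_sub_distrib, Finset.sum_const, Finset.card_univ,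
        nsmul_eq_mul, hμ]
      field_simp
      ring
    have h1 := hP _ h0
    -- Off `y` the section has sum zero, so subtracting `μ` there can only increase the sum of
    -- squares.
    have h2 : ∑ x, F (x, y) ^ 2 ≤ ∑ x, g x ^ 2 := by
      rw [← Finset.add_sum_erase Finset.univ (fun x => g x ^ 2) (Finset.mem_univ y)]
      have : ∑ x ∈ Finset.univ.erase y, g x ^ 2
          = ∑ x, F (x, y) ^ 2 + ∑ x ∈ Finset.univ.erase y, μ ^ 2 := by
        rw [← hsF2, ← add_zero (∑ x ∈ _, F (x, y) ^ 2), ← mul_zero (-2 * μ), ← hsF,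
          Finset.mul_sum, ← Finset.sum_add_distrib, ← Finset.sum_add_distrib]
        refine Finset.sum_congr rfl fun x hx => ?_
        rw [hgx, hhx x (Finset.ne_of_mem_erase hx)]
        ring
      rw [this]
      have : 0 ≤ ∑ x ∈ Finset.univ.erase y, μ ^ 2 := Finset.sum_nonneg fun _ _ => sq_nonneg _
      have := sq_nonneg (g y)
      linarith
    refine (mul_le_mul_of_nonneg_left h2 hγ).trans (h1.trans ?_)
    rw [hE, Finset.sum_filter, ← Finset.sum_add_distrib]
    refine Finset.sum_le_sum fun e he => ?_
    have hr := (H.rate_pos e he).le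
    have h3 : ∀ x, g x - edgeAvg e g x = h x - edgeAvg e h x :=
      fun x => by rw [hg, edgeAvg_sub, edgeAvg_const, Pi.sub_apply]; ring
    simp only [h3]
    have hle : ∑ x ∈ e, dev F e x y ^ 2 ≤ ∑ x, dev F e x y ^ 2 :=
      Finset.sum_le_sum_of_subset_of_nonneg (Finset.subset_univ e) fun _ _ _ => sq_nonneg _
    -- The local variance on `e` is bounded through a reference constant: `m e` for a nontrivial
    -- edge through `y`, `d y` for `e = {y}`, and for `y ∉ e` the average of `F` over `e` at `(x,
    -- y)`, which does not depend on `x ∈ e`.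
    by_cases hy : y ∈ e
    · by_cases hnt : e.Nontrivial
      · rw [if_pos ⟨hy, hnt⟩, ← mul_add]
        refine mul_le_mul_of_nonneg_left
          ((sum_sub_edgeAvg_sq_le_sum_mem e h (m e)).trans ?_) hr
        rw [← Finset.add_sum_erase _ _ hy, hhy, add_comm]
        gcongr
        refine le_trans (Finset.sum_le_sum fun x hx => ?_) ((Finset.sum_le_sum_of_subset_of_nonneg
          (Finset.erase_subset y e) fun _ _ _ => sq_nonneg _).trans hle)
        rw [hhx x (Finset.ne_of_mem_erase hx), dev,
          hm e x (Finset.mem_of_mem_erase hx) y hy (Finset.ne_of_mem_erase hx)]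
      · rw [if_neg (fun h => hnt h.2), add_zero]
        refine mul_le_mul_of_nonneg_left
          ((sum_sub_edgeAvg_sq_le_sum_mem e h (d y)).trans ?_) hr
        refine le_trans (Finset.sum_le_sum fun x hx => ?_) hle
        have : x = y := by
          by_contra hxy
          exact hnt ⟨x, hx, y, hy, hxy⟩
        rw [this, hhy, sub_self]
        simpa using sq_nonneg (dev F e y y)
    · rw [if_neg (fun h => hy h.1), add_zero]
      refine mul_le_mul_of_nonneg_left ?_ hr
      rcases e.eq_empty_or_nonempty with rfl | ⟨x₀, hx₀⟩
      · exact (sum_sub_edgeAvg_sq_le_sum_mem ∅ h 0).trans hle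
      · refine ((sum_sub_edgeAvg_sq_le_sum_mem e h (edgeAvg e F (x₀, y))).trans
          (Finset.sum_le_sum fun x hx => ?_)).trans hle
        rw [hhx x (fun h => hy (h ▸ hx)), dev, edgeAvg_pair_left F hx₀ hx hy]
  -- Each of the three copies of `devAt` in `G` sums to twice the squared deviation, so `36 = 6 * 3
  -- * 2`; the final constant is `73 = 1 + 2 * 36`.
  have hGsum : ∀ e, ∑ y, G e y = 36 * ∑ p, (F p - edgeAvg e F p) ^ 2 := fun e => by
    simp only [hG, ← Finset.mul_sum, Finset.sum_add_distrib]
    rw [Equiv.sum_comp (c e) (devAt F e), sum_devAt]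
    ring
  have hG0 : ∀ e y, 0 ≤ G e y := fun e y => by
    have := devAt_nonneg F e y
    have := devAt_nonneg F e (c e y)
    simp only [hG]
    positivity
  calc γ * ∑ p, F p ^ 2 = ∑ y, γ * ∑ x, F (x, y) ^ 2 := by
        rw [← Finset.mul_sum, Fintype.sum_prod_type, Finset.sum_comm]
    _ ≤ ∑ y, (∑ e ∈ H.edges, H.rate e * ∑ x, dev F e x y ^ 2
          + 2 * ∑ e ∈ H.edges, H.rate e * G e y) := by
        refine Finset.sum_le_sum fun y _ => (hrow y).trans ?_
        refine add_le_add le_rfl ((hd y).trans (mul_le_mul_of_nonneg_left ?_ two_pos.le))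
        exact Finset.sum_le_sum_of_subset_of_nonneg (Finset.filter_subset _ _)
          fun e he _ => mul_nonneg (H.rate_pos e he).le (hG0 e y)
    _ = ∑ e ∈ H.edges, H.rate e * (∑ y, ∑ x, dev F e x y ^ 2 + 2 * ∑ y, G e y) := by
        simp only [mul_add, Finset.sum_add_distrib, Finset.mul_sum]
        rw [Finset.sum_comm, Finset.sum_comm (s := Finset.univ) (t := H.edges)
          (f := fun y e => 2 * (H.rate e * G e y))]
        congr 1
        exact Finset.sum_congr rfl fun e _ => Finset.sum_congr rfl fun y _ => by ring
    _ = _ := by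
        rw [Finset.mul_sum]
        refine Finset.sum_congr rfl fun e _ => ?_
        rw [hGsum, Finset.sum_comm, Fintype.sum_prod_type]
        simp only [dev]
        ring

end Pairs

end RatedHypergraph

end

/-! ### The spectral gap of two particles. -/

noncomputable section

open scoped Matrix

namespace RatedHypergraph

variable {V : Type u} [Fintype V] [DecidableEq V]

/-- The two-particle configuration with positions `a` and `b`. -/
def pairEmb (a b : V) (h : a ≠ b) : Fin 2 ↪ V where
  toFun := ![a, b]
  inj' := by
    intro i j hij
    fin_cases i <;> fin_cases j <;> simp_all

/-- The positions of two particles. -/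
def pairPos (q : Fin 2 ↪ V) : V × V := (q 0, q 1)

omit [Fintype V] [DecidableEq V] in
theorem pairPos_smul (σ : Perm V) (q : Fin 2 ↪ V) : pairPos (σ • q) = σ • pairPos q := rfl

omit [Fintype V] [DecidableEq V] in
theorem pairPos_pairEmb (a b : V) (h : a ≠ b) : pairPos (pairEmb a b h) = (a, b) := rfl

omit [Fintype V] [DecidableEq V] in
theorem pairPos_injective : Function.Injective (pairPos : (Fin 2 ↪ V) → V × V) := fun p q h => by
  ext i
  have h0 : p 0 = q 0 := congrArg Prod.fst h
  have h1 : p 1 = q 1 := congrArg Prod.snd h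
  fin_cases i
  · exact h0
  · exact h1

theorem sum_pair (F : V × V → ℝ) (hdiag : ∀ x, F (x, x) = 0) :
    ∑ p, F p = ∑ q : Fin 2 ↪ V, F (pairPos q) := by
  symm
  refine Finset.sum_of_injOn pairPos (pairPos_injective.injOn) (fun _ _ => Finset.mem_univ _)
    (fun p _ hp => ?_) fun _ _ => rfl
  obtain ⟨a, b⟩ := p
  by_cases h : a = b
  · rw [h, hdiag]
  · exact absurd ⟨pairEmb a b h, by simp, rfl⟩ hp

theorem le_spectralGap_ip_two (H : RatedHypergraph V) {γ : ℝ} (hγ : 0 < γ)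
    (hgap : ENNReal.ofReal γ ≤ MarkovChain.spectralGap H.rw1 (MarkovChain.uniform V)) :
    ENNReal.ofReal (γ / 73)
      ≤ MarkovChain.spectralGap (H.ip 2) (MarkovChain.uniform (Fin 2 ↪ V)) := by
  classical
  rw [MarkovChain.le_spectralGap_iff (by positivity)]
  intro l f hf hf0 hl
  set F : V × V → ℝ := fun p => if h : p.1 ≠ p.2 then f (pairEmb p.1 p.2 h) else 0 with hF
  have hdiag : ∀ x, F (x, x) = 0 := fun x => by simp [hF]
  have hFf : F ∘ pairPos = f := by
    ext q
    have : q 0 ≠ q 1 := fun h => by simpa using q.injective h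
    have h2 : F (pairPos q) = f (pairEmb (q 0) (q 1) this) := by
      simp only [hF, pairPos, dif_pos this]
    rw [Function.comp_apply, h2]
    congr 1
    exact pairPos_injective rfl
  have hFl : H.generator (V × V) *ᵥ F = (-l) • F := by
    ext ⟨a, b⟩
    by_cases h : a = b
    · subst h
      rw [generator_mulVec, Pi.smul_apply, hdiag, smul_zero]
      refine Finset.sum_eq_zero fun e _ => ?_
      rw [edgeAvg_eq_of_forall (fun σ => hdiag _), sub_self, mul_zero]
    · have h1 := congrFun (H.generator_intertwine (pairPos : (Fin 2 ↪ V) → V × V)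
        pairPos_smul F) (pairEmb a b h)
      rw [hFf, Function.comp_apply, pairPos_pairEmb] at h1
      rw [← h1, ← pairPos_pairEmb a b h, Pi.smul_apply]
      have h2 := congrFun hl (pairEmb a b h)
      rw [Pi.smul_apply] at h2
      rw [show F (pairPos (pairEmb a b h)) = f (pairEmb a b h) from congrFun hFf _, ← h2]
      simp only [ip, generator_mulVec]
  have hmargl : H.rw1 *ᵥ (fun y => ∑ x, F (x, y)) = (-l) • fun y => ∑ x, F (x, y) := by
    ext y
    have h1 : ∀ e : Finset V, edgeAvg e (fun y => ∑ x, F (x, y)) y = ∑ x, edgeAvg e F (x, y) :=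
        fun e => by
      simp only [edgeAvg, ← Finset.sum_div]
      congr 1
      symm
      rw [Finset.sum_comm]
      refine Finset.sum_congr rfl fun σ _ => ?_
      exact (Equiv.sum_comp (Perm.ofSubtype σ) fun x => F (x, Perm.ofSubtype σ • y))
    have h2 : ∀ x, (H.generator (V × V) *ᵥ F) (x, y) = -l * F (x, y) := fun x => by
      rw [hFl]; rfl
    simp only [generator_mulVec] at h2
    simp only [rw1, generator_mulVec, Pi.smul_apply, smul_eq_mul, Finset.mul_sum, ← h2]
    rw [Finset.sum_comm]
    refine Finset.sum_congr rfl fun e _ => ?_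
    rw [h1, ← Finset.sum_sub_distrib, Finset.mul_sum]
  have hgap' := hgap
  rw [MarkovChain.le_spectralGap_iff hγ] at hgap'
  -- A nonzero marginal is a single-particle eigenfunction with the same `l`; zero marginals are
  -- what `pair_poincare` requires.
  by_cases hm : (fun y => ∑ x, F (x, y)) = 0
  · have hP : ∀ h : V → ℝ, ∑ x, h x = 0 →
        γ * ∑ x, h x ^ 2 ≤ ∑ e ∈ H.edges, H.rate e * ∑ x, (h x - edgeAvg e h x) ^ 2 :=
      fun h hh => by
        rw [← neg_sum_mul_generator_mulVec]
        exact MarkovChain.poincare_of_le_spectralGap (H.generator_isSymm V)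
          (H.generator_row_sum V) hγ hgap h hh
    have key := pair_poincare F H hP hγ.le (fun y => congrFun hm y) hdiag
    rw [← neg_sum_mul_generator_mulVec, hFl] at key
    have e1 : -∑ p, F p * ((-l) • F) p = l * ∑ p, F p ^ 2 := by
      rw [Finset.mul_sum, ← Finset.sum_neg_distrib]
      exact Finset.sum_congr rfl fun p _ => by simp only [Pi.smul_apply, smul_eq_mul]; ring
    rw [e1] at key
    have hpos : 0 < ∑ p, F p ^ 2 := by
      obtain ⟨q, hq⟩ := Function.ne_iff.1 hf
      refine Finset.sum_pos' (fun _ _ => sq_nonneg _) ⟨pairPos q, Finset.mem_univ _, ?_⟩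
      have : F (pairPos q) = f q := congrFun hFf q
      rw [this]
      exact sq_pos_of_ne_zero hq
    have : γ ≤ 73 * l := le_of_mul_le_mul_right (by linarith) hpos
    linarith
  · have := hgap' l _ hm (by
      rw [Finset.sum_comm, ← Fintype.sum_prod_type, sum_pair F hdiag, ← hf0]
      exact Finset.sum_congr rfl fun q _ => congrFun hFf q) hmargl
    linarith

end RatedHypergraph

end

/-! ### Replacing one particle by an independent walker. -/

noncomputable section

open scoped Matrix

namespace RatedHypergraph

open MarkovChain

variable {V : Type u} [Fintype V] [DecidableEq V] (H : RatedHypergraph V)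
  {ι : Type} [Fintype ι]

/-- The evolution in which the particles of `z` and the particle `v` move independently. -/
def indepSemigroup (F : (ι ↪ V) × V → ℝ) (r : ℝ) (p : (ι ↪ V) × V) : ℝ :=
  semigroup (H.generator (ι ↪ V)) r
    (fun z => semigroup (H.generator V) r (fun w => F (z, w)) p.2) p.1

/-- The rate at which the particle at `v` interacts with the particles of `z`. -/
def interactionRate (p : (ι ↪ V) × V) : ℝ :=
  ∑ j, ∑ e ∈ H.edges, H.rate e * if p.2 ∈ e ∧ p.1 j ∈ e then 1 else 0

theorem indepSemigroup_zero (F : (ι ↪ V) × V → ℝ) : H.indepSemigroup F 0 = F := by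
  ext ⟨z, v⟩
  simp [indepSemigroup]

theorem hasDerivAt_indepSemigroup (F : (ι ↪ V) × V → ℝ) (t : ℝ) (p : (ι ↪ V) × V) :
    HasDerivAt (fun r => H.indepSemigroup F r p)
      ((H.generator (ι ↪ V) *ᵥ fun z => H.indepSemigroup F t (z, p.2)) p.1
        + (H.generator V *ᵥ fun v => H.indepSemigroup F t (p.1, v)) p.2) t := by
  have h := hasDerivAt_semigroup_apply_of_hasDerivAt (H.generator (ι ↪ V))
    (fun u z => semigroup (H.generator V) u (fun w => F (z, w)) p.2)
    (fun z => semigroup (H.generator V) t (H.generator V *ᵥ fun w => F (z, w)) p.2) 1 0 t p.1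
    (fun z => hasDerivAt_semigroup_apply _ _ t p.2)
  simp only [zero_add, one_mul, one_smul] at h
  rw [semigroup_add_fun, semigroup_mulVec_comm, Pi.add_apply] at h
  refine h.congr_deriv (congrArg₂ (· + ·) rfl ?_)
  simp only [semigroup_mulVec_comm (H.generator V)]
  simp only [indepSemigroup, semigroup, Matrix.mulVec,
    dotProduct, Finset.mul_sum]
  rw [Finset.sum_comm]
  refine Finset.sum_congr rfl fun z _ => Finset.sum_congr rfl fun v _ =>
    Finset.sum_congr rfl fun w _ => by ring

/-- The generator of the interacting particles differs from that of the independent ones only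
through the interactions. -/
theorem abs_generator_sub_le {G : (ι ↪ V) × V → ℝ} {M : ℝ}
    (hG : ∀ z v v', |G (z, v) - G (z, v')| ≤ M) (p : (ι ↪ V) × V) :
    |(H.generator ((ι ↪ V) × V) *ᵥ G) p
      - ((H.generator (ι ↪ V) *ᵥ fun z => G (z, p.2)) p.1
        + (H.generator V *ᵥ fun v => G (p.1, v)) p.2)| ≤ 2 * M * H.interactionRate p := by
  obtain ⟨z, v⟩ := p
  have hM : 0 ≤ M := (abs_nonneg _).trans (hG z v v)
  simp only [generator_mulVec, interactionRate]
  rw [Finset.sum_comm, ← Finset.sum_add_distrib, ← Finset.sum_sub_distrib, Finset.mul_sum]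
  refine (Finset.abs_sum_le_sum_abs _ _).trans (Finset.sum_le_sum fun e he => ?_)
  have hr := (H.rate_pos e he).le
  have h0 : H.rate e * (edgeAvg e G (z, v) - G (z, v))
      - (H.rate e * (edgeAvg e (fun z => G (z, v)) z - G (z, v))
        + H.rate e * (edgeAvg e (fun v => G (z, v)) v - G (z, v)))
      = H.rate e * (edgeAvg e G (z, v) - edgeAvg e (fun z => G (z, v)) z
        - (edgeAvg e (fun v => G (z, v)) v - G (z, v))) := by ring
  rw [h0, abs_mul, abs_of_nonneg hr, ← Finset.mul_sum, mul_left_comm]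
  refine mul_le_mul_of_nonneg_left ?_ hr
  -- Only an edge containing both `v` and some `z j` contributes. Its error is a difference of two
  -- terms, each comparing values of `G` at configurations with the same `z`, hence at most `2 * M`.
  by_cases hv : v ∈ e
  · by_cases hz : ∃ j, z j ∈ e
    · obtain ⟨j, hj⟩ := hz
      have h1 : (1 : ℝ) ≤ ∑ j, if v ∈ e ∧ z j ∈ e then (1 : ℝ) else 0 := by
        have := Finset.single_le_sum (f := fun j => if v ∈ e ∧ z j ∈ e then (1 : ℝ) else 0)
          (fun j _ => by split_ifs <;> norm_num) (Finset.mem_univ j)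
        simpa [hv, hj] using this
      have b1 : |edgeAvg e G (z, v) - edgeAvg e (fun z => G (z, v)) z| ≤ M := by
        have h2 : edgeAvg e (fun z => G (z, v)) z
            = edgeAvg e (fun p : (ι ↪ V) × V => G (p.1, v)) (z, v) := rfl
        rw [h2, ← edgeAvg_sub]
        exact abs_edgeAvg_le fun σ => hG _ _ _
      have b2 : |edgeAvg e (fun v => G (z, v)) v - G (z, v)| ≤ M := by
        rw [← edgeAvg_const e (G (z, v)) v, ← edgeAvg_sub]
        exact abs_edgeAvg_le fun σ => hG _ _ _
      calc _ ≤ M + M := (abs_sub _ _).trans (add_le_add b1 b2)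
        _ = 2 * M * 1 := by ring
        _ ≤ _ := mul_le_mul_of_nonneg_left h1 (by positivity)
    · push Not at hz
      have hfix : ∀ σ : Perm {v // v ∈ e}, Perm.ofSubtype σ • z = z := fun σ => by
        ext j
        exact ofSubtype_apply_of_notMem σ (hz j)
      have e1 : edgeAvg e G (z, v) = edgeAvg e (fun v => G (z, v)) v := by
        simp only [edgeAvg, Prod.smul_mk, hfix]
      have e2 : edgeAvg e (fun z => G (z, v)) z = G (z, v) :=
        edgeAvg_eq_of_forall fun σ => by rw [hfix]
      rw [e1, e2, sub_self, abs_zero]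
      exact mul_nonneg (by positivity) (Finset.sum_nonneg fun j _ => by split_ifs <;> norm_num)
  · have hfix : ∀ σ : Perm {v // v ∈ e}, Perm.ofSubtype σ • v = v := fun σ =>
      ofSubtype_apply_of_notMem σ hv
    have e1 : edgeAvg e G (z, v) = edgeAvg e (fun z => G (z, v)) z := by
      simp only [edgeAvg, Prod.smul_mk, hfix]
    have e2 : edgeAvg e (fun v => G (z, v)) v = G (z, v) :=
      edgeAvg_eq_of_forall fun σ => by rw [hfix]
    rw [e1, e2, sub_self, sub_self, sub_self, abs_zero]
    exact mul_nonneg (by positivity) (Finset.sum_nonneg fun j _ => by split_ifs <;> norm_num)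

theorem abs_indepSemigroup_sub_le_of_forall {F : (ι ↪ V) × V → ℝ} {M r : ℝ} {v v' : V}
    (hr : 0 ≤ r)
    (hF : ∀ z, |semigroup (H.generator V) r (fun w => F (z, w)) v
      - semigroup (H.generator V) r (fun w => F (z, w)) v'| ≤ M) (z : ι ↪ V) :
    |H.indepSemigroup F r (z, v) - H.indepSemigroup F r (z, v')| ≤ M := by
  have h := abs_semigroup_le (H.generator_isQMatrix (S := ι ↪ V)) hr
    (f := (fun z => semigroup (H.generator V) r (fun w => F (z, w)) v)
      - fun z => semigroup (H.generator V) r (fun w => F (z, w)) v') (c := M) hF z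
  rwa [semigroup_sub_fun] at h

theorem abs_indepSemigroup_sub_le {F : (ι ↪ V) × V → ℝ} {M r : ℝ} (hr : 0 ≤ r)
    (hF : ∀ z v v', |F (z, v) - F (z, v')| ≤ M) (z : ι ↪ V) (v v' : V) :
    |H.indepSemigroup F r (z, v) - H.indepSemigroup F r (z, v')| ≤ M :=
  H.abs_indepSemigroup_sub_le_of_forall hr
    (fun z => abs_semigroup_sub_le H.generator_isQMatrix hr (hF z) v v') z

theorem abs_semigroup_sub_sum_uniform_le {T ε M : ℝ} {v : V} {h : V → ℝ}
    (hT : tvDist (law H.rw1 T v) (uniform V) ≤ ε) (hh : ∀ w w', |h w - h w'| ≤ M) :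
    |semigroup (H.generator V) T h v - ∑ w, uniform V w * h w| ≤ 2 * ε * M := by
  have hn : (Fintype.card V : ℝ) ≠ 0 := by
    have : Nonempty V := ⟨v⟩
    simp
  have hM : 0 ≤ M := (abs_nonneg _).trans (hh v v)
  have e1 : semigroup (H.generator V) T h v - ∑ w, uniform V w * h w
      = ∑ w, (law H.rw1 T v w - uniform V w) * (h w - h v) := by
    have h1 : ∑ w, law H.rw1 T v w * h v = h v := by
      rw [law_eq_semigroup H.rw1 T v fun _ => h v, rw1,
        semigroup_const _ (H.generator_row_sum V)]
    have h2 : ∑ w, uniform V w * h v = h v := by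
      rw [← Finset.sum_mul]
      simp [uniform, hn]
    rw [← law_eq_semigroup]
    simp only [sub_mul, mul_sub, Finset.sum_sub_distrib, h1, h2]
    change ∑ w, law H.rw1 T v w * h w - _ = _
    ring
  rw [e1]
  calc _ ≤ ∑ w, |law H.rw1 T v w - uniform V w| * M := by
        refine (Finset.abs_sum_le_sum_abs _ _).trans (Finset.sum_le_sum fun w _ => ?_)
        rw [abs_mul]
        exact mul_le_mul_of_nonneg_left (hh w v) (abs_nonneg _)
    _ = 2 * tvDist (law H.rw1 T v) (uniform V) * M := by
        rw [← Finset.sum_mul, tvDist]; ring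
    _ ≤ _ := by gcongr

theorem abs_indepSemigroup_sub_le_of_tvDist {F : (ι ↪ V) × V → ℝ} {M T ε : ℝ} (hT : 0 ≤ T)
    (hF : ∀ z v v', |F (z, v) - F (z, v')| ≤ M)
    (hmix : ∀ v, tvDist (law H.rw1 T v) (uniform V) ≤ ε) (z : ι ↪ V) (v v' : V) :
    |H.indepSemigroup F T (z, v) - H.indepSemigroup F T (z, v')| ≤ 4 * ε * M := by
  refine H.abs_indepSemigroup_sub_le_of_forall hT (fun z => ?_) z
  have h1 := H.abs_semigroup_sub_sum_uniform_le (hmix v) (hF z)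
  have h2 := H.abs_semigroup_sub_sum_uniform_le (hmix v') (hF z)
  rw [abs_le] at *
  constructor <;> linarith [h1.1, h1.2, h2.1, h2.2]

/-- Comparison of the interacting and the independent evolution after a burn-in time `s`. -/
theorem abs_semigroup_sub_semigroup_indepSemigroup_le {F : (ι ↪ V) × V → ℝ} {M s T K : ℝ}
    (hs : 0 ≤ s) (hT : 0 ≤ T) (hF : ∀ z v v', |F (z, v) - F (z, v')| ≤ M) (p : (ι ↪ V) × V)
    (hK : ∀ u, s ≤ u → semigroup (H.generator ((ι ↪ V) × V)) u H.interactionRate p ≤ K) :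
    |semigroup (H.generator ((ι ↪ V) × V)) (s + T) F p
      - semigroup (H.generator ((ι ↪ V) × V)) s (H.indepSemigroup F T) p| ≤ 2 * M * K * T := by
  set L := H.generator ((ι ↪ V) × V)
  have hM : 0 ≤ M := (abs_nonneg _).trans (hF p.1 p.2 p.2)
  set D : ℝ → (ι ↪ V) × V → ℝ := fun r q =>
    (H.generator (ι ↪ V) *ᵥ fun z => H.indepSemigroup F r (z, q.2)) q.1
        + (H.generator V *ᵥ fun v => H.indepSemigroup F r (q.1, v)) q.2
  -- Duhamel interpolation: interacting for time `s + u`, then independent for `T - u`. The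
  -- derivative is the difference of the generators, seen at times at least `s`, where `hK` controls
  -- the interaction rate.
  have hd : ∀ u, HasDerivAt (fun u => semigroup L (s + 1 * u) (H.indepSemigroup F (T - u)) p)
      (semigroup L (s + 1 * u) ((1 : ℝ) • L *ᵥ H.indepSemigroup F (T - u)
        + -(D (T - u))) p) u := fun u => by
    refine hasDerivAt_semigroup_apply_of_hasDerivAt L (fun u => H.indepSemigroup F (T - u))
      (-(D (T - u))) 1 s u p fun q => ?_
    have h1 := (H.hasDerivAt_indepSemigroup F (T - u) q).comp u
      ((hasDerivAt_id u).const_sub T)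
    refine h1.congr_deriv ?_
    simp only [mul_neg, mul_one, Pi.neg_apply, D]
  have hb : ∀ u ∈ Set.Ico 0 T, ‖semigroup L (s + 1 * u)
      ((1 : ℝ) • L *ᵥ H.indepSemigroup F (T - u) + -(D (T - u))) p‖ ≤ 2 * M * K := fun u hu => by
    have h2 : ∀ q, |((1 : ℝ) • L *ᵥ H.indepSemigroup F (T - u) + -(D (T - u))) q|
        ≤ ((2 * M) • H.interactionRate) q := fun q => by
      have := H.abs_generator_sub_le
        (H.abs_indepSemigroup_sub_le (sub_nonneg.2 hu.2.le) hF) q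
      rw [one_smul, ← sub_eq_add_neg]
      exact this
    have hu0 : 0 ≤ s + 1 * u := by linarith [hu.1]
    rw [Real.norm_eq_abs]
    refine (abs_semigroup_le_semigroup H.generator_isQMatrix hu0 h2 p).trans ?_
    rw [semigroup_smul_fun]
    exact mul_le_mul_of_nonneg_left (hK _ (by linarith [hu.1])) (by positivity)
  have := norm_image_sub_le_of_norm_deriv_le_segment'
    (fun u _ => (hd u).hasDerivWithinAt) hb T (Set.right_mem_Icc.2 hT)
  simpa [indepSemigroup_zero] using this

/-- Coupling two evolutions through the same permutations. -/
theorem abs_semigroup_sub_le_of_pair {G : (ι ↪ V) × V → ℝ} {M s : ℝ} (hs : 0 ≤ s)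
    (hG : ∀ z v v', |G (z, v) - G (z, v')| ≤ M) (z : ι ↪ V) (v v' : V) :
    |semigroup (H.generator ((ι ↪ V) × V)) s G (z, v)
      - semigroup (H.generator ((ι ↪ V) × V)) s G (z, v')| ≤ M := by
  have h := abs_semigroup_le (H.generator_isQMatrix (S := (ι ↪ V) × V × V)) hs
    (f := (G ∘ fun p : (ι ↪ V) × V × V => (p.1, p.2.1))
      - (G ∘ fun p : (ι ↪ V) × V × V => (p.1, p.2.2))) (c := M)
      (fun p => hG p.1 p.2.1 p.2.2) (z, v, v')
  rw [semigroup_sub_fun, H.semigroup_comp _ (fun _ _ => rfl),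
    H.semigroup_comp _ (fun _ _ => rfl)] at h
  exact h

/-- Each starting point pays `2 * M * K * T` for the replacement. The independent evolution then has
oscillation `4 * ε * M` in the last position, preserved by the common permutations of the burn-in.
-/
theorem abs_semigroup_sub_le_contraction {F : (ι ↪ V) × V → ℝ} {M s T K ε : ℝ}
    (hs : 0 ≤ s) (hT : 0 ≤ T) (hF : ∀ z v v', |F (z, v) - F (z, v')| ≤ M) (z : ι ↪ V) (v v' : V)
    (hmix : ∀ v, tvDist (law H.rw1 T v) (uniform V) ≤ ε)
    (hK : ∀ u, s ≤ u → semigroup (H.generator ((ι ↪ V) × V)) u H.interactionRate (z, v) ≤ K)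
    (hK' : ∀ u, s ≤ u → semigroup (H.generator ((ι ↪ V) × V)) u H.interactionRate (z, v') ≤ K) :
    |semigroup (H.generator ((ι ↪ V) × V)) (s + T) F (z, v)
      - semigroup (H.generator ((ι ↪ V) × V)) (s + T) F (z, v')| ≤ (4 * ε + 4 * (K * T)) * M := by
  have h1 := H.abs_semigroup_sub_semigroup_indepSemigroup_le hs hT hF _ hK
  have h2 := H.abs_semigroup_sub_semigroup_indepSemigroup_le hs hT hF _ hK'
  have h3 := H.abs_semigroup_sub_le_of_pair hs
    (H.abs_indepSemigroup_sub_le_of_tvDist hT hF hmix) z v v'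
  rw [abs_le] at *
  constructor <;> nlinarith [h1.1, h1.2, h2.1, h2.2, h3.1, h3.2]

end RatedHypergraph

end

/-! ### Interaction rates and the eigenvalue bound for `k` particles. -/

noncomputable section

open scoped Matrix

namespace RatedHypergraph

open MarkovChain

variable {V : Type u} [Fintype V] [DecidableEq V] (H : RatedHypergraph V) {k : ℕ}

omit [Fintype V] in
theorem ip_eq_generator (k : ℕ) : H.ip k = H.generator (Fin k ↪ V) := by
  unfold ip
  congr!

/-- The rate at which the two particles of `q` are permuted together. -/
def pairRate (q : Fin 2 ↪ V) : ℝ :=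
  ∑ e ∈ H.edges, H.rate e * if q 0 ∈ e ∧ q 1 ∈ e then 1 else 0

omit [Fintype V] in
theorem pairRate_nonneg (q : Fin 2 ↪ V) : 0 ≤ H.pairRate q :=
  Finset.sum_nonneg fun e he => mul_nonneg (H.rate_pos e he).le (by split_ifs <;> norm_num)

omit [Fintype V] [DecidableEq V] in
theorem R_nonneg : 0 ≤ H.R := by
  refine Finset.sum_nonneg fun e he => ?_
  rw [mul_assoc]
  refine mul_nonneg (H.rate_pos e he).le ?_
  rcases Nat.eq_zero_or_pos e.card with h | h
  · simp [h]
  · have : (1 : ℝ) ≤ e.card := by exact_mod_cast h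
    nlinarith

/-- An edge `e` contains `|e| (|e| - 1)` ordered pairs of distinct vertices, which is how `R`
enters. -/
theorem sum_pairRate : ∑ q, H.pairRate q = H.R := by
  simp only [pairRate, R]
  rw [Finset.sum_comm]
  refine Finset.sum_congr rfl fun e _ => ?_
  rw [← Finset.mul_sum, mul_assoc]
  congr 1
  have h := sum_pair (fun p : V × V => if p ∈ e.offDiag then (1 : ℝ) else 0) (fun x => by simp)
  have h2 : ∀ q : Fin 2 ↪ V, (if pairPos q ∈ e.offDiag then (1 : ℝ) else 0)
      = if q 0 ∈ e ∧ q 1 ∈ e then 1 else 0 := fun q => by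
    have : q 0 ≠ q 1 := fun h => by simpa using q.injective h
    simp [pairPos, Finset.mem_offDiag, this]
  simp only [h2] at h
  rw [← h, Finset.sum_boole]
  simp only [Finset.filter_univ_mem, Finset.offDiag_card]
  rw [Nat.cast_sub (Nat.le_mul_self _)]
  push_cast
  ring

/-- Past the time in `hexp`, every transition probability of two particles is at most twice uniform.
-/
theorem semigroup_pairRate_le {γ : ℝ} (hγ : 0 < γ)
    (hgap : ENNReal.ofReal γ ≤ spectralGap (H.ip 2) (uniform (Fin 2 ↪ V))) {u : ℝ} (hu : 0 ≤ u)
    (hexp : Real.exp (-(γ * u)) ≤ 1 / Fintype.card (Fin 2 ↪ V)) (q : Fin 2 ↪ V) :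
    semigroup (H.generator (Fin 2 ↪ V)) u H.pairRate q
      ≤ 2 / Fintype.card (Fin 2 ↪ V) * H.R := by
  rw [ip_eq_generator] at hgap
  rw [← H.sum_pairRate, Finset.mul_sum]
  refine Finset.sum_le_sum fun q' _ => mul_le_mul_of_nonneg_right ?_ (H.pairRate_nonneg q')
  have h := (abs_le.1 (abs_exp_apply_sub_le (H.generator_isSymm (Fin 2 ↪ V))
    (H.generator_row_sum _) hγ hgap hu q q')).2
  calc _ ≤ 1 / (Fintype.card (Fin 2 ↪ V) : ℝ) + 1 / Fintype.card (Fin 2 ↪ V) := by linarith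
    _ = _ := by ring

/-- The positions of the particles other than `i`. -/
def restrictEmb (i : Fin k) (x : Fin k ↪ V) : {j : Fin k // j ≠ i} ↪ V :=
  (Function.Embedding.subtype _).trans x

/-- The positions of the other particles and of particle `i`. -/
def splitPos (i : Fin k) (x : Fin k ↪ V) : ({j : Fin k // j ≠ i} ↪ V) × V :=
  (restrictEmb i x, x i)

omit [Fintype V] [DecidableEq V] in
theorem splitPos_smul (i : Fin k) (σ : Perm V) (x : Fin k ↪ V) :
    splitPos i (σ • x) = σ • splitPos i x := rfl

omit [Fintype V] [DecidableEq V] in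
theorem splitPos_injective (i : Fin k) :
    Function.Injective (splitPos i : (Fin k ↪ V) → _) := fun x y h => by
  ext j
  by_cases hj : j = i
  · rw [hj]; exact congrArg Prod.snd h
  · exact DFunLike.congr_fun (congrArg Prod.fst h) ⟨j, hj⟩

/-- The pair of particles `i` and `j`. -/
def pairOf (i : Fin k) (j : {j : Fin k // j ≠ i}) (x : Fin k ↪ V) : Fin 2 ↪ V :=
  (pairEmb i j.1 j.2.symm).trans x

theorem semigroup_interactionRate_le {K : ℝ} {u : ℝ}
    (hK : ∀ q, semigroup (H.generator (Fin 2 ↪ V)) u H.pairRate q ≤ K)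
    (i : Fin k) (x : Fin k ↪ V) :
    semigroup (H.generator (({j : Fin k // j ≠ i} ↪ V) × V)) u H.interactionRate (splitPos i x)
      ≤ (Fintype.card {j : Fin k // j ≠ i}) * K := by
  have h1 : (H.interactionRate : ({j : Fin k // j ≠ i} ↪ V) × V → ℝ) ∘ splitPos i
      = ∑ j, H.pairRate ∘ pairOf i j := by
    ext x
    rw [Finset.sum_apply]
    rfl
  have h2 := congrFun (H.semigroup_comp (splitPos i) (splitPos_smul i) u H.interactionRate) x
  rw [Function.comp_apply] at h2
  rw [← h2, h1, semigroup_sum_fun, Finset.sum_apply]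
  calc _ ≤ ∑ _j : {j : Fin k // j ≠ i}, K := Finset.sum_le_sum fun j _ => by
        rw [H.semigroup_comp (pairOf i j) (fun _ _ => rfl)]
        exact hK _
    _ = _ := by simp [Finset.card_univ]

omit [Fintype V] [DecidableEq V] in
/-- A function of `k` distinct vertices extends to configurations where particle `i` may collide
with the others, without increasing its oscillation in the position of particle `i`. -/
theorem exists_extension (i : Fin k) (f : (Fin k ↪ V) → ℝ) {M : ℝ} (hM : 0 ≤ M)
    (hf : ∀ x y, restrictEmb i x = restrictEmb i y → |f x - f y| ≤ M) :
    ∃ F : ({j : Fin k // j ≠ i} ↪ V) × V → ℝ, F ∘ splitPos i = f ∧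
      ∀ z v v', |F (z, v) - F (z, v')| ≤ M := by
  classical
  have h : ∀ p : ({j : Fin k // j ≠ i} ↪ V) × V, ∃ c : ℝ,
      (∀ x, splitPos i x = p → c = f x) ∧ (∀ y, restrictEmb i y = p.1 → |c - f y| ≤ M) ∧
      ((∃ x, restrictEmb i x = p.1) → ∃ x, restrictEmb i x = p.1 ∧ c = f x) ∧
      ((¬ ∃ x, restrictEmb i x = p.1) → c = 0) := fun p => by
    by_cases h1 : ∃ x, splitPos i x = p
    · obtain ⟨x, rfl⟩ := h1
      exact ⟨f x, fun y hy => by rw [splitPos_injective i hy], fun y hy => hf x y hy.symm,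
        fun _ => ⟨x, rfl, rfl⟩, fun h => absurd ⟨x, rfl⟩ h⟩
    -- A colliding configuration over `z` receives the value of `f` at some genuine configuration
    -- with the same other particles, so oscillations over `z` are oscillations of `f`.
    · by_cases h2 : ∃ x, restrictEmb i x = p.1
      · obtain ⟨x, hx⟩ := h2
        exact ⟨f x, fun y hy => absurd ⟨y, hy⟩ h1, fun y hy => hf x y (hx.trans hy.symm),
          fun _ => ⟨x, hx, rfl⟩, fun h => absurd ⟨x, hx⟩ h⟩
      · exact ⟨0, fun y hy => absurd ⟨y, hy⟩ h1, fun y hy => absurd ⟨y, hy⟩ h2,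
          fun h => absurd h h2, fun _ => rfl⟩
  choose F h1 h2 h3 h4 using h
  refine ⟨F, funext fun x => h1 _ x rfl, fun z v v' => ?_⟩
  by_cases hz : ∃ x, restrictEmb i x = z
  · obtain ⟨y, hy, hFy⟩ := h3 (z, v') hz
    rw [hFy]
    exact h2 (z, v) y hy
  · rw [h4 (z, v) hz, h4 (z, v') hz, sub_self, abs_zero]
    exact hM

omit [DecidableEq V] in
/-- A function of fewer than `|V|` distinct vertices that never changes when a single vertex is
moved is constant. -/
theorem eq_of_forall_restrictEmb_eq (hk : k < Fintype.card V) (f : (Fin k ↪ V) → ℝ)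
    (hf : ∀ i x y, restrictEmb i x = restrictEmb i y → f x = f y) (x y : Fin k ↪ V) :
    f x = f y := by
  classical
  have hout : ∀ x : Fin k ↪ V, ∃ u, ∀ j, x j ≠ u := fun x => by
    by_contra h
    push Not at h
    have := Fintype.card_le_of_surjective x h
    simp only [Fintype.card_fin] at this
    omega
  have h1 : ∀ (x : Fin k ↪ V) (v u : V), (∀ j, x j ≠ u) → f (swap v u • x) = f x := by
    intro x v u hu
    by_cases hv : ∃ i, x i = v
    · obtain ⟨i, rfl⟩ := hv
      refine hf i _ _ ?_
      ext ⟨j, hj⟩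
      exact swap_apply_of_ne_of_ne (fun h => hj (x.injective h)) (hu j)
    · push Not at hv
      congr 1
      ext j
      exact swap_apply_of_ne_of_ne (hv j) (hu j)
  have h2 : ∀ (x : Fin k ↪ V) (v w : V), f (swap v w • x) = f x := by
    intro x v w
    by_cases hw : ∀ j, x j ≠ w
    · exact h1 x v w hw
    by_cases hv : ∀ j, x j ≠ v
    · rw [swap_comm]; exact h1 x w v hv
    by_cases hvw : v = w
    · rw [hvw, swap_self]
      exact congrArg f (one_smul _ x)
    obtain ⟨u, hu⟩ := hout x
    have huv : u ≠ v := by rintro rfl; exact hv hu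
    have huw : u ≠ w := by rintro rfl; exact hw hu
    -- Two occupied vertices are exchanged by three single-particle moves through the empty vertex
    -- `u`.
    have e1 : swap v w • x = swap u w • swap w v • swap v u • x := by
      ext j
      change swap v w (x j) = swap u w (swap w v (swap v u (x j)))
      have := hu j
      by_cases ha : x j = v
      · rw [ha, swap_apply_left, swap_apply_left, swap_apply_of_ne_of_ne huw huv,
          swap_apply_left]
      · rw [swap_apply_of_ne_of_ne ha this]
        by_cases hb : x j = w
        · rw [hb, swap_apply_right, swap_apply_left, swap_apply_of_ne_of_ne huv.symm hvw]
        · rw [swap_apply_of_ne_of_ne ha hb, swap_apply_of_ne_of_ne hb ha,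
            swap_apply_of_ne_of_ne this hb]
    have f1 : ∀ j, (swap v u • x) j ≠ v := fun j h => by
      have h' : swap v u (x j) = v := h
      rw [swap_apply_eq_iff, swap_apply_left] at h'
      exact hu j h'
    have f2 : ∀ j, (swap w v • swap v u • x) j ≠ w := fun j h => by
      have h' : swap w v ((swap v u • x) j) = w := h
      rw [swap_apply_eq_iff, swap_apply_left] at h'
      exact f1 j h'
    rw [e1, h1 _ u w f2, h1 _ w v f1, h1 x v u hu]
  have h3 : ∀ (σ : Perm V) (x : Fin k ↪ V), f (σ • x) = f x := by
    intro σ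
    induction σ using Perm.swap_induction_on with
    | one => intro x; rw [one_smul]
    | swap_mul τ a b _ ih => intro x; rw [mul_smul, h2, ih]
  obtain ⟨σ, hσ⟩ := (Equiv.Perm.isMultiplyPretransitive V k).exists_smul_eq x y
  rw [← hσ, h3]

/-- The semigroup multiplies the largest single-particle variation `M` of `f` by `exp (-l (s + T))`,
while the comparison with an independent walker bounds the result by a small multiple of `M`. -/
theorem exp_eigenvalue_le (hk : k < Fintype.card V) {f : (Fin k ↪ V) → ℝ} (hf : f ≠ 0)
    (hsum : ∑ x, f x = 0) {l : ℝ} (hl : H.ip k *ᵥ f = (-l) • f) {s T ε K : ℝ} (hs : 0 ≤ s)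
    (hT : 0 ≤ T) (hmix : ∀ v, tvDist (law H.rw1 T v) (uniform V) ≤ ε) (hK0 : 0 ≤ K)
    (hK : ∀ q u, s ≤ u → semigroup (H.generator (Fin 2 ↪ V)) u H.pairRate q ≤ K) :
    Real.exp (-l * (s + T)) ≤ 4 * ε + 4 * (k * K * T) := by
  classical
  rw [ip_eq_generator] at hl
  -- `M > 0` needs `k < |V|`: with no empty vertex, no particle can be moved alone.
  have hne : ∃ i x y, restrictEmb i x = restrictEmb i y ∧ f x ≠ f y := by
    by_contra h
    push Not at h
    have hc := eq_of_forall_restrictEmb_eq hk f h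
    obtain ⟨x, hx⟩ := Function.ne_iff.1 hf
    rw [Finset.sum_congr rfl fun y _ => hc y x, Finset.sum_const, nsmul_eq_mul,
      mul_eq_zero] at hsum
    rcases hsum with h0 | h0
    · rw [Nat.cast_eq_zero, Finset.card_eq_zero] at h0
      exact absurd (Finset.mem_univ x) (by simp [h0])
    · exact hx h0
  obtain ⟨i₀, x₀, y₀, h₀, hn₀⟩ := hne
  set A : Finset (Fin k × (Fin k ↪ V) × (Fin k ↪ V)) :=
    Finset.univ.filter fun a => restrictEmb a.1 a.2.1 = restrictEmb a.1 a.2.2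
  have hA₀ : (i₀, x₀, y₀) ∈ A := by simp [A, h₀]
  obtain ⟨⟨i, x, y⟩, hA, hmax⟩ := A.exists_max_image (fun a => |f a.2.1 - f a.2.2|) ⟨_, hA₀⟩
  have hxy : restrictEmb i x = restrictEmb i y := by simpa [A] using hA
  set M := |f x - f y| with hMdef
  have hM : 0 < M := lt_of_lt_of_le (abs_pos.2 (sub_ne_zero.2 hn₀)) (hmax _ hA₀)
  obtain ⟨F, hF, hosc⟩ := exists_extension i f hM.le
    (fun x' y' h => hmax (i, x', y') (by simp [A, h]))
  have hKi : ∀ x : Fin k ↪ V, ∀ u, s ≤ u →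
      semigroup (H.generator (({j : Fin k // j ≠ i} ↪ V) × V)) u H.interactionRate (splitPos i x)
        ≤ k * K := fun x u hu => by
    refine (H.semigroup_interactionRate_le (fun q => hK q u hu) i x).trans ?_
    refine mul_le_mul_of_nonneg_right ?_ hK0
    have := Fintype.card_subtype_le (fun j : Fin k => j ≠ i)
    rw [Fintype.card_fin] at this
    exact_mod_cast this
  have hsg : ∀ x, semigroup (H.generator (({j : Fin k // j ≠ i} ↪ V) × V)) (s + T) F
      (splitPos i x) = Real.exp (-l * (s + T)) * f x := fun x => by
    have h1 := congrFun (H.semigroup_comp (splitPos i) (splitPos_smul i) (s + T) F) x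
    rw [hF, semigroup_of_mulVec_eq_smul _ f (-l) hl, Function.comp_apply] at h1
    rw [← h1]; rfl
  have hy : splitPos i y = (restrictEmb i x, y i) := by rw [splitPos, hxy]
  have key := H.abs_semigroup_sub_le_contraction hs hT hosc (restrictEmb i x) (x i) (y i) hmix
    (hKi x) (by rw [← hy]; exact hKi y)
  rw [← hy, hsg y, show (restrictEmb i x, x i) = splitPos i x from rfl, hsg x, ← mul_sub, abs_mul,
    abs_of_pos (Real.exp_pos _)] at key
  exact le_of_mul_le_mul_right key hM

end RatedHypergraph

end

/-! ### From eigenvalue bounds to relaxation and mixing times. -/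

noncomputable section

open scoped Matrix

namespace MarkovChain

theorem relaxationTime_le_of_spectralGap {S S' : Type*} [Fintype S] [Fintype S']
    {Q : Matrix S S ℝ} {Q' : Matrix S' S' ℝ} {π : S → ℝ} {π' : S' → ℝ} {c : ℝ} (hc : 0 < c)
    (h : ∀ γ : ℝ, 0 < γ → ENNReal.ofReal γ ≤ spectralGap Q π →
      ENNReal.ofReal (γ / c) ≤ spectralGap Q' π') :
    relaxationTime Q' π' ≤ ENNReal.ofReal c * relaxationTime Q π := by
  unfold relaxationTime
  rcases eq_or_ne (spectralGap Q π) 0 with h0 | h0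
  · rw [h0, ENNReal.inv_zero, ENNReal.mul_top (by simpa using hc)]
    exact le_top
  rcases eq_or_ne (spectralGap Q π) ⊤ with h1 | h1
  · have : spectralGap Q' π' = ⊤ := ENNReal.eq_top_of_forall_nnreal_le fun r => by
      have h2 := h (c * (r + 1)) (by positivity) (by rw [h1]; exact le_top)
      rw [mul_div_cancel_left₀ _ hc.ne'] at h2
      refine le_trans ?_ h2
      rw [← ENNReal.ofReal_coe_nnreal]
      exact ENNReal.ofReal_le_ofReal (by linarith)
    rw [this]
    simp
  · have hpos := ENNReal.toReal_pos h0 h1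
    have h2 := h _ hpos (ENNReal.ofReal_toReal h1).le
    refine (ENNReal.inv_le_inv.2 h2).trans ?_
    rw [← ENNReal.ofReal_inv_of_pos (by positivity), inv_div, div_eq_mul_inv,
      ENNReal.ofReal_mul hc.le, ENNReal.ofReal_inv_of_pos hpos, ENNReal.ofReal_toReal h1]

/-- A time at which the chain is mixed, from a bound on a multiple of the mixing time. -/
theorem exists_time_of_mul_mixingTime_le {S : Type*} [Fintype S] [DecidableEq S]
    {Q : Matrix S S ℝ} {π : S → ℝ} {ε a p T₁ : ℝ} (ha : 0 ≤ a) (hp : 0 < p) (hT₁ : 0 ≤ T₁)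
    (hmix : ∀ x, tvDist (law Q T₁ x) π ≤ ε)
    (h : ENNReal.ofReal a * mixingTime Q π ε ≤ ENNReal.ofReal p) :
    ∃ T, 0 ≤ T ∧ T ≤ T₁ ∧ a * T ≤ 2 * p ∧ ∀ x, tvDist (law Q T x) π ≤ ε := by
  -- If `T₁` itself is cheap it is used, which covers `a = 0`. Otherwise a time near the infimum is
  -- used; the factor 2 leaves room for an infimum that need not be attained.
  by_cases h1 : a * T₁ ≤ 2 * p
  · exact ⟨T₁, hT₁, le_rfl, h1, hmix⟩
  push Not at h1
  have ha' : 0 < a := by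
    rcases ha.eq_or_lt with h0 | h0
    · rw [← h0] at h1; linarith
    · exact h0
  have h2 : mixingTime Q π ε < ENNReal.ofReal (2 * p / a) := by
    by_contra h3
    push Not at h3
    have h4 := (mul_le_mul_right h3 (ENNReal.ofReal a)).trans h
    rw [← ENNReal.ofReal_mul ha, mul_div_cancel₀ _ ha'.ne'] at h4
    rw [ENNReal.ofReal_le_ofReal_iff hp.le] at h4
    linarith
  simp only [mixingTime, iInf_lt_iff] at h2
  obtain ⟨t, ht, hlt⟩ := h2
  rw [← ENNReal.ofReal_coe_nnreal, ENNReal.ofReal_lt_ofReal_iff (by positivity),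
    lt_div_iff₀ ha'] at hlt
  exact ⟨t, t.2, by nlinarith, by linarith, fun x => by convert ht x⟩

end MarkovChain

namespace RatedHypergraph

open MarkovChain

variable {V : Type u} [Fintype V] [DecidableEq V] (H : RatedHypergraph V)

/-- At this time every transition probability is within `n ^ (-2)` of uniform. -/
theorem tvDist_law_le_of_gap [Nonempty V] {γ b : ℝ} (hγ : 0 < γ) (hb : b ≤ 1)
    (hgap : ENNReal.ofReal γ ≤ spectralGap H.rw1 (uniform V)) (v : V) :
    tvDist (law H.rw1 (2 * Real.log (Fintype.card V) / γ) v) (uniform V)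
      ≤ (Fintype.card V : ℝ) ^ (-b) := by
  set n : ℝ := (Fintype.card V : ℝ) with hn
  have hn1 : 1 ≤ n := by rw [hn]; exact_mod_cast Fintype.card_pos
  have hlog : 0 ≤ Real.log n := Real.log_nonneg hn1
  have h1 : ∀ w, |law H.rw1 (2 * Real.log n / γ) v w - uniform V w| ≤ n⁻¹ * n⁻¹ := fun w => by
    refine (abs_exp_apply_sub_le (H.generator_isSymm V) (H.generator_row_sum V) hγ hgap
      (by positivity) v w).trans_eq ?_
    rw [mul_div_cancel₀ _ hγ.ne', two_mul, neg_add, Real.exp_add, Real.exp_neg,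
      Real.exp_log (by linarith)]
  calc _ ≤ 1 / 2 * ∑ _w : V, n⁻¹ * n⁻¹ :=
        mul_le_mul_of_nonneg_left (Finset.sum_le_sum fun w _ => h1 w) (by norm_num)
    _ = 1 / 2 * n ^ (-1 : ℝ) := by
        rw [Finset.sum_const, Finset.card_univ, nsmul_eq_mul, Real.rpow_neg_one]
        change 1 / 2 * (n * _) = _
        field_simp
    _ ≤ 1 * n ^ (-1 : ℝ) := by gcongr; norm_num
    _ ≤ _ := by rw [one_mul]; exact Real.rpow_le_rpow_of_exponent_le hn1 (by linarith)

theorem neg_R_le_trace : -H.R ≤ ∑ x, H.rw1 x x := by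
  simp only [rw1, generator, Matrix.of_apply, R]
  rw [Finset.sum_comm, ← Finset.sum_neg_distrib]
  refine Finset.sum_le_sum fun e he => ?_
  have hr := (H.rate_pos e he).le
  have h1 : ∀ x, -(if x ∈ e then (e.card : ℝ) - 1 else 0)
      ≤ edgeAvg e (fun y => if y = x then (1 : ℝ) else 0) x - 1 := fun x => by
    by_cases hfix : ∀ σ : Perm {v // v ∈ e}, Perm.ofSubtype σ • x = x
    · rw [edgeAvg_eq_of_forall (c := 1) fun σ => by simp [hfix σ], sub_self]
      split_ifs with hx
      · have : (1 : ℝ) ≤ e.card := by exact_mod_cast Finset.card_pos.2 ⟨x, hx⟩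
        linarith
      · simp
    · push Not at hfix
      obtain ⟨σ, hσ⟩ := hfix
      have hx : x ∈ e := by
        by_contra hx
        exact hσ (ofSubtype_apply_of_notMem σ hx)
      have h2 : (2 : ℝ) ≤ e.card := by
        exact_mod_cast Finset.one_lt_card.2 ⟨_, ofSubtype_apply_mem σ hx, x, hx, hσ⟩
      have h3 : 0 ≤ edgeAvg e (fun y => if y = x then (1 : ℝ) else 0) x :=
        div_nonneg (Finset.sum_nonneg fun σ _ => by dsimp only; split_ifs <;> norm_num)
          (by positivity)
      rw [if_pos hx]
      linarith
  rw [← Finset.mul_sum, mul_assoc, ← mul_neg]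
  refine mul_le_mul_of_nonneg_left ?_ hr
  calc -((e.card : ℝ) * (e.card - 1)) = ∑ x, -(if x ∈ e then (e.card : ℝ) - 1 else 0) := by
        rw [Finset.sum_neg_distrib, Finset.sum_ite_mem, Finset.univ_inter, Finset.sum_const,
          nsmul_eq_mul]
    _ ≤ _ := Finset.sum_le_sum fun x _ => by
        rw [if_pos trivial]
        exact h1 x

/-- Mixing requires the particles to move. -/
theorem card_le_of_mixed {T ε : ℝ} (hT : 0 ≤ T)
    (hmix : ∀ v, tvDist (law H.rw1 T v) (uniform V) ≤ ε) :
    (Fintype.card V : ℝ) ≤ 1 + Fintype.card V * (2 * ε) + T * H.R := by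
  -- Summed over `x`, this compares two bounds for the trace of the transition matrix: staying put
  -- from below, mixing from above.
  have h1 : ∀ x, 1 + T * H.rw1 x x ≤ 1 / Fintype.card V + 2 * ε := fun x => by
    have h2 := one_add_le_exp_apply_self (H.generator_isQMatrix (S := V)) hT x
    have h3 : |law H.rw1 T x x - uniform V x| ≤ 2 * ε := by
      have h4 := Finset.single_le_sum (f := fun w => |law H.rw1 T x w - uniform V w|)
        (fun _ _ => abs_nonneg _) (Finset.mem_univ x)
      have h5 := hmix x
      rw [tvDist] at h5
      linarith
    have h6 := (abs_le.1 h3).2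
    simp only [law, uniform] at h6
    simp only [rw1] at h6 ⊢
    linarith
  have h2 := Finset.sum_le_sum fun x (_ : x ∈ Finset.univ) => h1 x
  rw [Finset.sum_add_distrib, ← Finset.mul_sum] at h2
  simp only [Finset.sum_const, Finset.card_univ, nsmul_eq_mul, mul_one, mul_add] at h2
  have h3 := mul_le_mul_of_nonneg_left H.neg_R_le_trace hT
  have h4 : (Fintype.card V : ℝ) * (1 / Fintype.card V) ≤ 1 := by
    rw [mul_one_div]
    exact div_self_le_one _
  linarith

theorem le_spectralGap_ip {b γ : ℝ} (hb : 0 < b) (hb1 : b ≤ 1) (hγ : 0 < γ) {k : ℕ}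
    (hn : 2 ≤ Fintype.card V) (hk : k ≤ Fintype.card V)
    (hnb : (Fintype.card V : ℝ) ^ (-(b / 2)) ≤ 1 / 36)
    (hR : ENNReal.ofReal (H.R * (k : ℝ) / (Fintype.card V : ℝ) ^ 2) *
        mixingTime H.rw1 (uniform V) ((Fintype.card V : ℝ) ^ (-b))
          ≤ ENNReal.ofReal ((Fintype.card V : ℝ) ^ (-b)))
    (hgap : ENNReal.ofReal γ ≤ spectralGap H.rw1 (uniform V)) :
    ENNReal.ofReal (γ / (296 * b⁻¹)) ≤ spectralGap (H.ip k) (uniform (Fin k ↪ V)) := by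
  have : Nonempty V := Fintype.card_pos_iff.1 (by omega)
  have hcard2 : (Fintype.card (Fin 2 ↪ V) : ℝ) = Fintype.card V * (Fintype.card V - 1) := by
    rw [Fintype.card_embedding_eq, Fintype.card_fin]
    simp only [Nat.descFactorial_succ, Nat.descFactorial_zero, mul_one, Nat.sub_zero]
    rw [Nat.cast_mul, Nat.cast_sub (by omega), mul_comm]
    simp
  have hmix₁ := H.tvDist_law_le_of_gap hγ hb1 hgap
  set n : ℝ := (Fintype.card V : ℝ) with hndef
  have hn2 : 2 ≤ n := by rw [hndef]; exact_mod_cast hn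
  have hn0 : 0 < n := by linarith
  have hlog : 0 < Real.log n := Real.log_pos (by linarith)
  set p : ℝ := n ^ (-b) with hp
  have hp0 : 0 < p := Real.rpow_pos_of_pos hn0 _
  have hpq : p = n ^ (-(b / 2)) * n ^ (-(b / 2)) := by
    rw [hp, ← Real.rpow_add hn0]; ring_nf
  have hq0 : 0 < n ^ (-(b / 2)) := Real.rpow_pos_of_pos hn0 _
  have hp36 : 36 * p ≤ n ^ (-(b / 2)) := by rw [hpq]; nlinarith
  have hRn := H.R_nonneg
  obtain ⟨T, hT0, hT1, haT, hmix⟩ := exists_time_of_mul_mixingTime_le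
    (by positivity) hp0 (by positivity) hmix₁ hR
  -- If `k = n`, the hypothesis gives `T R ≤ 2 n p`, too little movement for the walk to be mixed at
  -- time `T`.
  have hkn : k < Fintype.card V := by
    refine lt_of_le_of_ne hk fun hkeq => ?_
    have h1 := H.card_le_of_mixed hT0 hmix
    rw [hkeq] at haT
    have h2 : T * H.R ≤ n * (2 * p) := by
      have : H.R * n / n ^ 2 * T = T * H.R / n := by field_simp
      rw [← hndef, this, div_le_iff₀ hn0] at haT
      linarith
    have : p ≤ 1 / 36 := by linarith
    change n ≤ 1 + n * (2 * p) + T * H.R at h1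
    nlinarith
  have hγ2 : 0 < γ / 73 := by positivity
  have hgap2 := H.le_spectralGap_ip_two hγ hgap
  set N : ℝ := (Fintype.card (Fin 2 ↪ V) : ℝ) with hN
  have hN0 : 0 < N := by rw [hcard2]; nlinarith
  have hs : 0 ≤ 146 * Real.log n / γ := by positivity
  -- The burn-in is `146 = 2 * 73` times `log n / γ`: with two-particle gap at least `γ / 73`, the
  -- error is then at most `n ^ (-2) ≤ 1 / N`.
  have hK : ∀ q u, 146 * Real.log n / γ ≤ u →
      semigroup (H.generator (Fin 2 ↪ V)) u H.pairRate q ≤ 2 / N * H.R := fun q u hu => by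
    refine H.semigroup_pairRate_le hγ2 hgap2 (hs.trans hu) ?_ q
    calc Real.exp (-(γ / 73 * u)) ≤ Real.exp (-(2 * Real.log n)) := by
          refine Real.exp_le_exp.2 (neg_le_neg ?_)
          rw [div_le_iff₀ hγ] at hu
          linarith
      _ = 1 / (n * n) := by
          rw [two_mul, neg_add, Real.exp_add, Real.exp_neg, Real.exp_log hn0]
          field_simp
      _ ≤ 1 / N := one_div_le_one_div_of_le hN0 (by rw [hcard2]; nlinarith)
  -- Here `N = n (n - 1) ≥ n ^ 2 / 2`. With the `4 * p` from mixing, the total is `4 * p + 4 * 8 * p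
  -- = 36 * p`, hence the 36 in `hnb`.
  have hKle : k * (2 / N * H.R) * T ≤ 8 * p := by
    have h1 : 2 / N ≤ 4 / n ^ 2 := by
      rw [div_le_div_iff₀ hN0 (by positivity), hcard2]
      nlinarith
    calc k * (2 / N * H.R) * T ≤ k * (4 / n ^ 2 * H.R) * T := by gcongr
      _ = 4 * (H.R * k / n ^ 2 * T) := by ring
      _ ≤ _ := by linarith
  rw [le_spectralGap_iff (by positivity)]
  intro l f hf hf0 hl
  have key := H.exp_eigenvalue_le hkn hf hf0 hl hs hT0 hmix (by positivity) hK
  have h1 : Real.exp (-l * (146 * Real.log n / γ + T)) ≤ Real.exp (Real.log n * (-(b / 2))) := by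
    rw [← Real.rpow_def_of_pos hn0]
    linarith
  rw [Real.exp_le_exp] at h1
  by_contra hlt
  push Not at hlt
  have h2 : γ / (296 * b⁻¹) = b * γ / 296 := by field_simp
  rw [h2] at hlt
  -- As `T ≤ 2 log n / γ`, the total time is at most `148 log n / γ`; against a decay of `n ^ (-(b /
  -- 2))` this gives `296 = 2 * 148`.
  have h3 : 146 * Real.log n / γ + T ≤ 148 * Real.log n / γ :=
    (add_le_add_right hT1 _).trans_eq (by ring)
  have h4 : 0 < 146 * Real.log n / γ + T := by positivity
  have h5 : l * (146 * Real.log n / γ + T) < b * γ / 296 * (146 * Real.log n / γ + T) :=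
    mul_lt_mul_of_pos_right hlt h4
  have h6 : b * γ / 296 * (146 * Real.log n / γ + T) ≤ b * γ / 296 * (148 * Real.log n / γ) :=
    mul_le_mul_of_nonneg_left h3 (by positivity)
  have h7 : b * γ / 296 * (148 * Real.log n / γ) = Real.log n * (b / 2) := by
    field_simp
    ring
  linarith

end RatedHypergraph

end

theorem theorem1p4 :
    ∃ C : ℝ, 0 < C ∧
      (∀ b : ℝ, 0 < b → b ≤ 1 → ∃ n₀ : ℕ,
        ∀ (V : Type u) [Fintype V] [DecidableEq V] (H : RatedHypergraph V) (k : ℕ),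
          n₀ ≤ Fintype.card V → 1 ≤ k → k ≤ Fintype.card V →
          ENNReal.ofReal (H.R * (k : ℝ) / (Fintype.card V : ℝ) ^ 2) *
              MarkovChain.mixingTime H.rw1 (MarkovChain.uniform V)
                ((Fintype.card V : ℝ) ^ (-b))
            ≤ ENNReal.ofReal ((Fintype.card V : ℝ) ^ (-b)) →
          MarkovChain.relaxationTime (H.ip k) (MarkovChain.uniform (Fin k ↪ V))
            ≤ ENNReal.ofReal (C * b⁻¹) *
                MarkovChain.relaxationTime H.rw1 (MarkovChain.uniform V)) ∧
      (∀ (V : Type u) [Fintype V] [DecidableEq V] (H : RatedHypergraph V),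
        2 ≤ Fintype.card V →
          MarkovChain.relaxationTime (H.ip 2) (MarkovChain.uniform (Fin 2 ↪ V))
            ≤ ENNReal.ofReal C *
                MarkovChain.relaxationTime H.rw1 (MarkovChain.uniform V)) := by
  -- The two-particle bound only needs 73, so 296 serves both statements.
  refine ⟨296, by norm_num, fun b hb hb1 => ?_, fun V _ _ H hn => ?_⟩
  · have hlim : Filter.Tendsto (fun n : ℕ => (n : ℝ) ^ (-(b / 2))) Filter.atTop (nhds 0) :=
      (tendsto_rpow_neg_atTop (by positivity)).comp tendsto_natCast_atTop_atTop
    obtain ⟨n₀, hn₀⟩ := Filter.eventually_atTop.1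
      (hlim.eventually (ge_mem_nhds (show (0 : ℝ) < 1 / 36 by norm_num)))
    refine ⟨max n₀ 2, fun V _ _ H k hn _ hk hR => ?_⟩
    exact MarkovChain.relaxationTime_le_of_spectralGap (by positivity) fun γ hγ hgap =>
      H.le_spectralGap_ip hb hb1 hγ ((le_max_right _ _).trans hn) hk
        (hn₀ _ ((le_max_left _ _).trans hn)) hR hgap
  · refine MarkovChain.relaxationTime_le_of_spectralGap (by norm_num) fun γ hγ hgap =>
      le_trans (ENNReal.ofReal_le_ofReal ?_) (H.le_spectralGap_ip_two hγ hgap)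
    exact div_le_div_of_nonneg_left hγ.le (by norm_num) (by norm_num)
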